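/- Let $c\in\mathbb R\setminus\{0\}$ and $f(u,v)=\frac{u-v+ic}{u-v}$, $g(u,v)=\frac{ic}{u-v}$, $S(u)=\frac{u-ic}{u+ic}$. Consider the algebraic Bethe Ansatz of the one-dimensional Bose gas with coupling $c$: operators $A,B,C,D$ (the entries of the monodromy matrix $T(\lambda)$, with the exchange relations of the XXX-type R-matrix), a vacuum with $A(\lambda)|0\rangle=a(\lambda)|0\rangle$, $D(\lambda)|0\rangle=d(\lambda)|0\rangle$, $C(\lambda)|0\rangle=0$, $\langle0|D(\lambda)=d(\lambda)\langle0|$, $\langle 0|B(\lambda)=0$, $\langle0|0\rangle=1$, and the Bose field $\Psi=\Psi(0)$ with $\Psi|0\rangle=0$, $\langle0|\Psi^\dagger=0$. Explicitly, $$A(\lambda)B(\mu)=f(\lambda,\mu)B(\mu)A(\lambda)+g(\mu,\lambda)B(\lambda)A(\mu),\qquad D(\lambda)B(\mu)=f(\mu,\lambda)B(\mu)D(\lambda)+g(\lambda,\mu)B(\lambda)D(\mu),$$ $$[C(\lambda),B(\mu)]=g(\lambda,\mu)\bigl(A(\lambda)D(\mu)-A(\mu)D(\lambda)\bigr),\qquad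 C(\mu)D(\lambda)=f(\mu,\lambda)D(\lambda)C(\mu)+g(\lambda,\mu)D(\mu)C(\lambda),$$ $$[\Psi,B(\lambda)]=-i\sqrt c\,A(\lambda),\qquad [C(\lambda),\Psi^\dagger]=i\sqrt c\,D(\lambda).$$ With $\mathbb B=B/d$, $\mathbb C=C/d$, $l=a/d$, let $$M^k_{2N}(\{\lambda^C\},\{\lambda^B\},\{l^C\},\{l^B\})=\langle0|\prod_{j=1}^N\mathbb C(\lambda^C_j)\,(\Psi^\dagger)^k\Psi^k\prod_{j=1}^N\mathbb B(\lambda^B_j)|0\rangle ,$$ computed from these relations only, with $\Psi$ acting to the right and $\Psi^\dagger$ to the left, as a function of $4N$ independent variables (where $l^{C}_j=l(\lambda^{C}_j)$, $l^B_j=l(\lambda^B_j)$). The form factor $\mathbb F^k_{2N}(\{\lambda^C\}_N|\{\lambda^B\}_N)$ is its value when the $l$-variables of each of the two sets are given by the Bethe equations $l_j\prod_{m\neq j}S(\lambda_m-\lambda_j)=1$ for that set. Let $k\ge 0$, $N\ge1$. Let $\lambda^B_1,\dots,\lambda^B_N,\lambda^C_1,\dots,\lambda^C_{N-1}\in\mathbb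 C$ be pairwise distinct, such that no two elements of $\{\lambda^B_1,\dots,\lambda^B_N\}$ and no two elements of $\{\lambda^C_1,\dots,\lambda^C_{N-1},\lambda^B_N\}$ differ by $\pm ic$ (this is automatic for real rapidities). Put $$K(\lambda^C_N)=\prod_{j=1}^{N-1}f(\lambda^C_j,\lambda^C_N)f(\lambda^B_N,\lambda^B_j)-\prod_{j=1}^{N-1}f(\lambda^B_j,\lambda^B_N)f(\lambda^C_N,\lambda^C_j),$$ which does not depend on $k$. Then, as a function of $\lambda^C_N$ in a punctured neighbourhood of $\lambda^B_N$, $$\mathbb F^k_{2N}(\{\lambda^C\}_N|\{\lambda^B\}_N)=\frac{ic}{\lambda^C_N-\lambda^B_N}\,K(\lambda^C_N)\,\mathbb F^k_{2N-2}(\{\lambda^C\}_{N-1}|\{\lambda^B\}_{N-1})+h(\lambda^C_N)$$ with $h$ analytic at $\lambda^B_N$. In particular $\lim_{\lambda^C_N\to\lambda^B_N}(\lambda^C_N-\lambda^B_N)\,\mathbb F^k_{2N}=ic\,K(\lambda^B_N)\,\mathbb F^k_{2N-2}$, and whenever $K(\lambda^B_N)\,\mathbb F^k_{2N-2}\ne0$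 the form factor has a simple pole at $\lambda^C_N=\lambda^B_N$ (its meromorphic order there is exactly $-1$). -/

import Mathlib

open Filter Topology

noncomputable section

namespace BoseGas

/-- The function `f(u,v) = (u - v + ic) / (u - v)`. -/
def f (c : ℝ) (u v : ℂ) : ℂ := (u - v + Complex.I * c) / (u - v)

/-- The function `g(u,v) = ic / (u - v)`. -/
def g (c : ℝ) (u v : ℂ) : ℂ := Complex.I * c / (u - v)

/-- The two-particle S-matrix `S(u) = (u - ic) / (u + ic)`. -/
def S (c : ℝ) (u : ℂ) : ℂ := (u - Complex.I * c) / (u + Complex.I * c)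

/-- The square root `√c` of the coupling (the principal one). -/
def sqrtC (c : ℝ) : ℂ := (c : ℂ) ^ (1 / 2 : ℂ)

/-- A spectral parameter `lam` together with the value `l` at it of the ratio `a/d` of the vacuum
eigenvalues. The value `l` is a variable of its own, independent of `lam`. -/
structure Spec where
  lam : ℂ
  l : ℂ

/-- Formal complex linear combinations of words of spectral parameters. Such a word stands either
for a ket `[w₁, …, wₙ] = 𝔹(w₁) ⋯ 𝔹(wₙ)|0⟩` or for a bra `[w₁, …, wₙ] = ⟨0|ℂ(wₙ) ⋯ ℂ(w₁)`.
In both cases the head of the list is the operator farthest from the vacuum. -/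
abbrev Words : Type := List Spec →₀ ℂ

/-- Add the letter `x` as the new head of every word: on kets this is left multiplication
by `𝔹(x)`, on bras it is right multiplication by `ℂ(x)`. -/
def cons (x : Spec) : Words →ₗ[ℂ] Words := Finsupp.lmapDomain ℂ ℂ (List.cons x)

/- The operators below are `𝔸 = A/d`, `𝔹 = B/d`, `ℂ = C/d`, `𝔻 = D/d`. They satisfy the same
quadratic (RTT) relations as the entries `A, B, C, D` of the monodromy matrix, and on the vacuum
`𝔸(x)|0⟩ = l(x)|0⟩`, `𝔻(x)|0⟩ = |0⟩`, `ℂ(x)|0⟩ = 0`, `⟨0|𝔻(x) = ⟨0|`, `⟨0|𝔹(x) = 0`.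
The matrix elements are computed from these rules by moving operators towards the vacuum. -/

/-- The vector `𝔸(x) 𝔹(w₁) ⋯ 𝔹(wₙ)|0⟩`, by the exchange relation
`A(x) B(y) = f(x,y) B(y) A(x) + g(y,x) B(x) A(y)`. -/
def actA (c : ℝ) : Spec → List Spec → Words
  | x, [] => Finsupp.single [] x.l
  | x, y :: w => f c x.lam y.lam • cons y (actA c x w) + g c y.lam x.lam • cons x (actA c y w)

/-- The vector `𝔻(x) 𝔹(w₁) ⋯ 𝔹(wₙ)|0⟩`, by the exchange relation
`D(x) B(y) = f(y,x) B(y) D(x) + g(x,y) B(x) D(y)`. -/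
def actD (c : ℝ) : Spec → List Spec → Words
  | _, [] => Finsupp.single [] 1
  | x, y :: w => f c y.lam x.lam • cons y (actD c x w) + g c x.lam y.lam • cons x (actD c y w)

/-- The operator `𝔸(x)` on kets. -/
def opA (c : ℝ) (x : Spec) : Words →ₗ[ℂ] Words := Finsupp.linearCombination ℂ (actA c x)

/-- The operator `𝔻(x)` on kets. -/
def opD (c : ℝ) (x : Spec) : Words →ₗ[ℂ] Words := Finsupp.linearCombination ℂ (actD c x)

/-- The vector `ℂ(x) 𝔹(w₁) ⋯ 𝔹(wₙ)|0⟩`, by the exchange relation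
`C(x) B(y) = B(y) C(x) + g(x,y) (A(x) D(y) - A(y) D(x))`. -/
def actC (c : ℝ) : Spec → List Spec → Words
  | _, [] => 0
  | x, y :: w => cons y (actC c x w) +
      g c x.lam y.lam • (opA c x (actD c y w) - opA c y (actD c x w))

/-- The operator `ℂ(x)` on kets. -/
def opC (c : ℝ) (x : Spec) : Words →ₗ[ℂ] Words := Finsupp.linearCombination ℂ (actC c x)

/-- The vector `Ψ 𝔹(w₁) ⋯ 𝔹(wₙ)|0⟩` for the Bose field `Ψ = Ψ(0)`, by `Ψ|0⟩ = 0` and the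
commutator `[Ψ, B(y)] = -i√c A(y)`. -/
def actPsi (c : ℝ) : List Spec → Words
  | [] => 0
  | y :: w => cons y (actPsi c w) + (-Complex.I * sqrtC c) • actA c y w

/-- The operator `Ψ` on kets. -/
def opPsi (c : ℝ) : Words →ₗ[ℂ] Words := Finsupp.linearCombination ℂ (actPsi c)

/-- The bra `⟨0|ℂ(wₙ) ⋯ ℂ(w₁) 𝔻(x)`, by the exchange relation
`C(y) D(x) = f(y,x) D(x) C(y) + g(x,y) D(y) C(x)`. -/
def braD (c : ℝ) : Spec → List Spec → Words
  | _, [] => Finsupp.single [] 1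
  | x, y :: w => f c y.lam x.lam • cons y (braD c x w) + g c x.lam y.lam • cons x (braD c y w)

/-- The bra `⟨0|ℂ(wₙ) ⋯ ℂ(w₁) Ψ†`, by `⟨0|Ψ† = 0` and the commutator
`[C(y), Ψ†] = i√c D(y)`. -/
def braPsiDag (c : ℝ) : List Spec → Words
  | [] => 0
  | y :: w => cons y (braPsiDag c w) + (Complex.I * sqrtC c) • braD c y w

/-- Right multiplication of bras by `Ψ†`. -/
def opPsiDag (c : ℝ) : Words →ₗ[ℂ] Words := Finsupp.linearCombination ℂ (braPsiDag c)

/-- The number `⟨0|ℂ(wₙ) ⋯ ℂ(w₁) v`: let `ℂ(w₁)`, then `ℂ(w₂)`, and so on act on the ket `v`;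
by `⟨0|𝔹 = 0` and `⟨0|0⟩ = 1` the result is the coefficient of the empty word. -/
def braWord (c : ℝ) (w : List Spec) (v : Words) : ℂ :=
  (w.foldl (fun u x => opC c x u) v) []

/-- The pairing of a bra with a ket. -/
def pairing (c : ℝ) (φ v : Words) : ℂ := φ.sum fun w a => a * braWord c w v

/-- The word made of `N` rapidities `lam` and vacuum eigenvalue ratios `l`. -/
def word {N : ℕ} (lam l : Fin N → ℂ) : List Spec := List.ofFn fun j => ⟨lam j, l j⟩

/-- The off-shell matrix element
`M^k_{2N} = ⟨0| ∏_{j=1}^N ℂ(λ^C_j) (Ψ†)^k Ψ^k ∏_{j=1}^N 𝔹(λ^B_j) |0⟩`, a function of the `4N`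
variables `λ^C`, `λ^B`, `l^C`, `l^B`. -/
def offShell (c : ℝ) (k : ℕ) {N : ℕ} (lamC lamB lC lB : Fin N → ℂ) : ℂ :=
  pairing c ((opPsiDag c)^[k] (Finsupp.single (word lamC lC).reverse 1))
    ((opPsi c)^[k] (Finsupp.single (word lamB lB) 1))

/-- The Bethe equations `l_j ∏_{k ≠ j} S(λ_k - λ_j) = 1`, `j = 1, …, N`. -/
def BetheEq (c : ℝ) {N : ℕ} (lam l : Fin N → ℂ) : Prop :=
  ∀ j, l j * ∏ k ∈ Finset.univ.erase j, S c (lam k - lam j) = 1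

/-- The values of the variables `l_j` that the Bethe equations prescribe for the rapidities. -/
def betheL (c : ℝ) {N : ℕ} (lam : Fin N → ℂ) (j : Fin N) : ℂ :=
  (∏ k ∈ Finset.univ.erase j, S c (lam k - lam j))⁻¹

theorem betheEq_iff (c : ℝ) {N : ℕ} (lam l : Fin N → ℂ)
    (h : ∀ i j, i ≠ j → lam i - lam j ≠ Complex.I * c) :
    BetheEq c lam l ↔ l = betheL c lam := by
  have hS : ∀ j, ∏ k ∈ Finset.univ.erase j, S c (lam k - lam j) ≠ 0 := by
    intro j
    refine Finset.prod_ne_zero_iff.mpr fun k hk => ?_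
    have hkj : k ≠ j := (Finset.mem_erase.mp hk).1
    refine div_ne_zero (sub_ne_zero.mpr (h k j hkj)) fun h0 => h j k hkj.symm ?_
    linear_combination -h0
  constructor
  · intro hB
    funext j
    exact eq_inv_of_mul_eq_one_left (hB j)
  · rintro rfl j
    exact inv_mul_cancel₀ (hS j)

/-- The on-shell form factor `𝔽^k_{2N}(λ^C | λ^B)` of `(Ψ†)^k Ψ^k`: the matrix element with
both sets of variables `l` eliminated by the Bethe equations. -/
def formFactor (c : ℝ) (k : ℕ) {N : ℕ} (lamC lamB : Fin N → ℂ) : ℂ :=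
  offShell c k lamC lamB (betheL c lamC) (betheL c lamB)

/-- The difference of products
`∏_j f(x_j, z) f(b, y_j) - ∏_j f(y_j, b) f(z, x_j)`, where `x`, `y` are the rapidities
`λ^C_j`, `λ^B_j` with `j < N`, and `z`, `b` are `λ^C_N`, `λ^B_N`. -/
def kinFactor (c : ℝ) {n : ℕ} (x y : Fin n → ℂ) (z b : ℂ) : ℂ :=
  ∏ j, (f c (x j) z * f c b (y j)) - ∏ j, (f c (y j) b * f c z (x j))

end BoseGas

end

noncomputable section

namespace BoseGas

/-! ### Vectors supported on a set of words -/

section Support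

variable {α N : Type*} [AddCommGroup N] [Module ℂ N]

/-! The whole pole comes from one commutator. Write `z` for `λ^C_N` and `b` for `λ^B_N`. If `ℂ(z)`
stands next to the bra vacuum, it acts on the ket last. Since each `ℂ` removes one letter, only
one-letter words then contribute, so `z` meets `b` only in `ℂ(z)𝔹(b)|0⟩ = g(z,b)(l(z) - l(b))|0⟩`.
Every other coefficient is analytic at `b`. This gives `𝔽 = g(z,b)(l(z) - l(b)) E(z) + H(z)` with
`E`, `H` analytic (`pairing_residue`).

Moving `ℂ(z)` to that place requires the operators `ℂ` to commute, which the definition by ordered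
words does not provide. On words with distinct rapidities, modulo the order of letters, the
operators descend to multisets and satisfy the remaining exchange relations, up to `ketC_ketC`;
hence `pairing_perm`.

The value `E(b)` is found by deleting the letter nearest the vacuum from bra and ket. Deletion
intertwines all operators (`opStrip_actA` and its companions) once each remaining letter `s` is
given the weight `f(b,s)` and `l(s)` is multiplied by `f(s,b)/f(b,s)`. The Bethe equations turn the
modified `l` into the on-shell values of the smaller sets (`shift_betheL`), so `E(b) = ∏ f(b,x_j)
f(b,y_j) · 𝔽_{2N-2}`. They also give `l(z)` and `l(b)` at `z = b` (`betheL_snoc_last_mul`), so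
`(l(z) - l(b)) E(z)` takes the value `K(b) 𝔽_{2N-2}` there. Replacing it by `K(z) 𝔽_{2N-2}` near `b`
changes only the analytic part. -/

theorem eq_of_mem_supported {s : Set α} {φ ψ : (α →₀ ℂ) →ₗ[ℂ] N}
    (h : ∀ a ∈ s, φ (Finsupp.single a 1) = ψ (Finsupp.single a 1)) {u : α →₀ ℂ}
    (hu : u ∈ Finsupp.supported ℂ ℂ s) : φ u = ψ u := by
  rw [Finsupp.supported_eq_span_single] at hu
  refine LinearMap.eqOn_span ?_ hu
  rintro _ ⟨a, ha, rfl⟩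
  exact h a ha

theorem map_mem_of_mem_supported {s : Set α} {φ : (α →₀ ℂ) →ₗ[ℂ] N} {p : Submodule ℂ N}
    (h : ∀ a ∈ s, φ (Finsupp.single a 1) ∈ p) {u : α →₀ ℂ}
    (hu : u ∈ Finsupp.supported ℂ ℂ s) : φ u ∈ p := by
  rw [Finsupp.supported_eq_span_single] at hu
  have : Submodule.span ℂ ((fun i => Finsupp.single i (1 : ℂ)) '' s) ≤ p.comap φ := by
    rw [Submodule.span_le]
    rintro _ ⟨a, ha, rfl⟩
    exact h a ha
  exact this hu

end Support

@[simp] theorem cons_single (x : Spec) (w : List Spec) (a : ℂ) :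
    cons x (Finsupp.single w a) = Finsupp.single (x :: w) a := by
  simp [cons]

@[simp] theorem opA_single (c : ℝ) (x : Spec) (w : List Spec) :
    opA c x (Finsupp.single w 1) = actA c x w := by simp [opA]

@[simp] theorem opD_single (c : ℝ) (x : Spec) (w : List Spec) :
    opD c x (Finsupp.single w 1) = actD c x w := by simp [opD]

@[simp] theorem opC_single (c : ℝ) (x : Spec) (w : List Spec) :
    opC c x (Finsupp.single w 1) = actC c x w := by simp [opC]

@[simp] theorem opPsi_single (c : ℝ) (w : List Spec) :
    opPsi c (Finsupp.single w 1) = actPsi c w := by simp [opPsi]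

@[simp] theorem opPsiDag_single (c : ℝ) (w : List Spec) :
    opPsiDag c (Finsupp.single w 1) = braPsiDag c w := by simp [opPsiDag]

/-- Bras and kets obey the same exchange rule with `𝔻`. -/
theorem braD_eq_actD (c : ℝ) : ∀ (x : Spec) (w : List Spec), braD c x w = actD c x w
  | _, [] => rfl
  | x, y :: w => by rw [braD, actD, braD_eq_actD c x w, braD_eq_actD c y w]

/-! ### Words with pairwise distinct rapidities -/

/-- The words with pairwise distinct rapidities taken from `U`. -/
def distinctWords (U : Set ℂ) : Set (List Spec) :=
  {w | (w.map Spec.lam).Nodup ∧ ∀ s ∈ w, s.lam ∈ U}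

/-- The span of the words with pairwise distinct rapidities taken from `U`. -/
abbrev WordsOn (U : Set ℂ) : Submodule ℂ Words := Finsupp.supported ℂ ℂ (distinctWords U)

theorem WordsOn.mono {U V : Set ℂ} (h : U ⊆ V) : WordsOn U ≤ WordsOn V :=
  Finsupp.supported_mono fun _ hw => ⟨hw.1, fun s hs => h (hw.2 s hs)⟩

theorem single_mem_wordsOn {U : Set ℂ} {w : List Spec} (h : w ∈ distinctWords U) :
    (Finsupp.single w 1 : Words) ∈ WordsOn U := Finsupp.single_mem_supported ℂ 1 h

theorem cons_mem_distinctWords {U : Set ℂ} {x : Spec} {w : List Spec} :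
    x :: w ∈ distinctWords U ↔ x.lam ∈ U ∧ w ∈ distinctWords (U \ {x.lam}) := by
  simp only [distinctWords, Set.mem_ofPred_eq, List.map_cons, List.nodup_cons, List.mem_map,
    List.mem_cons, forall_eq_or_imp, Set.mem_sdiff, Set.mem_singleton_iff]
  grind

theorem cons_mem_wordsOn {U V : Set ℂ} {x : Spec} (hx : x.lam ∉ U) (hxV : x.lam ∈ V)
    (hUV : U ⊆ V) {u : Words} (hu : u ∈ WordsOn U) : cons x u ∈ WordsOn V := by
  refine map_mem_of_mem_supported (fun w hw => ?_) hu
  rw [cons_single]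
  refine single_mem_wordsOn
    (cons_mem_distinctWords.2 ⟨hxV, hw.1, fun s hs => ⟨hUV (hw.2 s hs), ?_⟩⟩)
  rintro h
  exact hx (h ▸ hw.2 s hs)

/-- An exchange only hands the spectral parameter on: each resulting word misses exactly one letter
of `x :: w` and repeats none. Rapidities therefore stay distinct, and the relations below are never
used at coinciding arguments of `f` or `g`. -/
theorem actA_mem (c : ℝ) : ∀ (w : List Spec) (x : Spec) (U : Set ℂ), x.lam ∉ U →
    w ∈ distinctWords U → actA c x w ∈ WordsOn (insert x.lam U)
  | [], x, U, _, _ => by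
    rw [actA]
    exact Finsupp.single_mem_supported ℂ _ (by simp [distinctWords])
  | y :: w, x, U, hx, hw => by
    obtain ⟨hy, hw⟩ := cons_mem_distinctWords.1 hw
    have hxy : x.lam ≠ y.lam := fun h => hx (h ▸ hy)
    rw [actA]
    refine add_mem (Submodule.smul_mem _ _ ?_) (Submodule.smul_mem _ _ ?_)
    · refine cons_mem_wordsOn ?_ (.inr hy) ?_ (actA_mem c w x _ (fun h => hx h.1) hw)
      · simp [hxy.symm]
      · exact Set.insert_subset_insert Set.sdiff_subset
    · refine cons_mem_wordsOn hx (.inl rfl) (Set.subset_insert _ _)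
        (WordsOn.mono ?_ (actA_mem c w y _ (by simp) hw))
      grind

theorem actD_mem (c : ℝ) : ∀ (w : List Spec) (x : Spec) (U : Set ℂ), x.lam ∉ U →
    w ∈ distinctWords U → actD c x w ∈ WordsOn (insert x.lam U)
  | [], x, U, _, _ => by
    rw [actD]
    exact Finsupp.single_mem_supported ℂ _ (by simp [distinctWords])
  | y :: w, x, U, hx, hw => by
    obtain ⟨hy, hw⟩ := cons_mem_distinctWords.1 hw
    have hxy : x.lam ≠ y.lam := fun h => hx (h ▸ hy)
    rw [actD]
    refine add_mem (Submodule.smul_mem _ _ ?_) (Submodule.smul_mem _ _ ?_)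
    · refine cons_mem_wordsOn ?_ (.inr hy) ?_ (actD_mem c w x _ (fun h => hx h.1) hw)
      · simp [hxy.symm]
      · exact Set.insert_subset_insert Set.sdiff_subset
    · refine cons_mem_wordsOn hx (.inl rfl) (Set.subset_insert _ _)
        (WordsOn.mono ?_ (actD_mem c w y _ (by simp) hw))
      grind

theorem opA_mem (c : ℝ) {x : Spec} {U : Set ℂ} (hx : x.lam ∉ U) {u : Words}
    (hu : u ∈ WordsOn U) : opA c x u ∈ WordsOn (insert x.lam U) :=
  map_mem_of_mem_supported (fun w hw => by simpa using actA_mem c w x U hx hw) hu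

theorem actC_mem (c : ℝ) : ∀ (w : List Spec) (x : Spec) (U : Set ℂ), x.lam ∉ U →
    w ∈ distinctWords U → actC c x w ∈ WordsOn (insert x.lam U)
  | [], x, U, _, _ => by
    rw [actC]
    exact zero_mem _
  | y :: w, x, U, hx, hw => by
    obtain ⟨hy, hw⟩ := cons_mem_distinctWords.1 hw
    have hxy : x.lam ≠ y.lam := fun h => hx (h ▸ hy)
    have hxU : x.lam ∉ U \ {y.lam} := fun h => hx h.1
    rw [actC]
    refine add_mem ?_ (Submodule.smul_mem _ _ (sub_mem ?_ ?_))
    · refine cons_mem_wordsOn ?_ (.inr hy) ?_ (actC_mem c w x _ hxU hw)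
      · simp [hxy.symm]
      · exact Set.insert_subset_insert Set.sdiff_subset
    · refine WordsOn.mono ?_ (opA_mem c (by simp [hxy, hx]) (actD_mem c w y _ (by simp) hw))
      grind
    · refine WordsOn.mono ?_ (opA_mem c (by simp [hxy.symm]) (actD_mem c w x _ hxU hw))
      grind

theorem opC_mem (c : ℝ) {x : Spec} {U : Set ℂ} (hx : x.lam ∉ U) {u : Words}
    (hu : u ∈ WordsOn U) : opC c x u ∈ WordsOn (insert x.lam U) :=
  map_mem_of_mem_supported (fun w hw => by simpa using actC_mem c w x U hx hw) hu

theorem actPsi_mem (c : ℝ) : ∀ (w : List Spec) (U : Set ℂ),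
    w ∈ distinctWords U → actPsi c w ∈ WordsOn U
  | [], U, _ => zero_mem _
  | y :: w, U, hw => by
    obtain ⟨hy, hw⟩ := cons_mem_distinctWords.1 hw
    rw [actPsi]
    refine add_mem (cons_mem_wordsOn (by simp) hy Set.sdiff_subset (actPsi_mem c w _ hw))
      (Submodule.smul_mem _ _ (WordsOn.mono ?_ (actA_mem c w y _ (by simp) hw)))
    grind

theorem braPsiDag_mem (c : ℝ) : ∀ (w : List Spec) (U : Set ℂ),
    w ∈ distinctWords U → braPsiDag c w ∈ WordsOn U
  | [], U, _ => zero_mem _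
  | y :: w, U, hw => by
    obtain ⟨hy, hw⟩ := cons_mem_distinctWords.1 hw
    rw [braPsiDag, braD_eq_actD]
    refine add_mem (cons_mem_wordsOn (by simp) hy Set.sdiff_subset (braPsiDag_mem c w _ hw))
      (Submodule.smul_mem _ _ (WordsOn.mono ?_ (actD_mem c w y _ (by simp) hw)))
    grind

theorem opPsi_mem (c : ℝ) {U : Set ℂ} {u : Words} (hu : u ∈ WordsOn U) :
    opPsi c u ∈ WordsOn U :=
  map_mem_of_mem_supported (fun w hw => by simpa using actPsi_mem c w U hw) hu

theorem opPsiDag_mem (c : ℝ) {U : Set ℂ} {u : Words} (hu : u ∈ WordsOn U) :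
    opPsiDag c u ∈ WordsOn U :=
  map_mem_of_mem_supported (fun w hw => by simpa using braPsiDag_mem c w U hw) hu

/-! ### Vectors modulo the commutativity of the letters -/

/-- Formal linear combinations of multisets of spectral parameters: words up to the order of
the letters. -/
abbrev Kets : Type := Multiset Spec →₀ ℂ

/-- Forget the order of the letters. -/
def toKet : Words →ₗ[ℂ] Kets := Finsupp.lmapDomain ℂ ℂ fun w => (w : Multiset Spec)

/-- Add the letter `x`. -/
def ketB (x : Spec) : Kets →ₗ[ℂ] Kets := Finsupp.lmapDomain ℂ ℂ (Multiset.cons x)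

@[simp] theorem toKet_single (w : List Spec) (a : ℂ) :
    toKet (Finsupp.single w a) = Finsupp.single (w : Multiset Spec) a := by
  simp [toKet]

@[simp] theorem ketB_single (x : Spec) (m : Multiset Spec) (a : ℂ) :
    ketB x (Finsupp.single m a) = Finsupp.single (x ::ₘ m) a := by
  simp [ketB]

theorem toKet_cons (x : Spec) (u : Words) : toKet (cons x u) = ketB x (toKet u) := by
  have : toKet ∘ₗ cons x = ketB x ∘ₗ toKet := by
    ext w
    simp
  exact LinearMap.congr_fun this u

theorem ketB_comm (x y : Spec) (u : Kets) : ketB x (ketB y u) = ketB y (ketB x u) := by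
  have : ketB x ∘ₗ ketB y = ketB y ∘ₗ ketB x := by
    ext w
    simp [Multiset.cons_swap]
  exact LinearMap.congr_fun this u

/-- The only real case is a transposition of adjacent letters, where compatibility of the `𝔸𝔹`
exchange with `[𝔹,𝔹] = 0` is a rational identity between `f` and `g`. Distinct rapidities keep the
denominators nonzero. -/
theorem actA_perm (c : ℝ) {w w' : List Spec} (h : w.Perm w') : ∀ x : Spec,
    ((x :: w).map Spec.lam).Nodup → toKet (actA c x w) = toKet (actA c x w') := by
  induction h with
  | nil => simp
  | trans h₁ _ ih₁ ih₂ =>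
    intro x hx
    rw [ih₁ x hx, ih₂ x (((h₁.cons x).map _).nodup_iff.1 hx)]
  | cons y _ ih =>
    intro x hx
    have h₁ := ih x (by grind)
    have h₂ := ih y (by grind)
    simp only [actA, map_add, map_smul, toKet_cons, h₁, h₂]
  | swap y z w =>
    intro x hx
    have hxy : x.lam - y.lam ≠ 0 := sub_ne_zero.2 (by grind)
    have hxz : x.lam - z.lam ≠ 0 := sub_ne_zero.2 (by grind)
    have hyz : y.lam - z.lam ≠ 0 := sub_ne_zero.2 (by grind)
    have hyx : y.lam - x.lam ≠ 0 := sub_ne_zero.2 (by grind)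
    have hzx : z.lam - x.lam ≠ 0 := sub_ne_zero.2 (by grind)
    have hzy : z.lam - y.lam ≠ 0 := sub_ne_zero.2 (by grind)
    simp only [actA, map_add, map_smul, toKet_cons, ketB_comm z y, ketB_comm z x, ketB_comm y x,
      f, g]
    match_scalars <;> field_simp <;> ring

theorem actD_perm (c : ℝ) {w w' : List Spec} (h : w.Perm w') : ∀ x : Spec,
    ((x :: w).map Spec.lam).Nodup → toKet (actD c x w) = toKet (actD c x w') := by
  induction h with
  | nil => simp
  | trans h₁ _ ih₁ ih₂ =>
    intro x hx
    rw [ih₁ x hx, ih₂ x (((h₁.cons x).map _).nodup_iff.1 hx)]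
  | cons y _ ih =>
    intro x hx
    have h₁ := ih x (by grind)
    have h₂ := ih y (by grind)
    simp only [actD, map_add, map_smul, toKet_cons, h₁, h₂]
  | swap y z w =>
    intro x hx
    have hxy : x.lam - y.lam ≠ 0 := sub_ne_zero.2 (by grind)
    have hxz : x.lam - z.lam ≠ 0 := sub_ne_zero.2 (by grind)
    have hyz : y.lam - z.lam ≠ 0 := sub_ne_zero.2 (by grind)
    have hyx : y.lam - x.lam ≠ 0 := sub_ne_zero.2 (by grind)
    have hzx : z.lam - x.lam ≠ 0 := sub_ne_zero.2 (by grind)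
    have hzy : z.lam - y.lam ≠ 0 := sub_ne_zero.2 (by grind)
    simp only [actD, map_add, map_smul, toKet_cons, ketB_comm z y, ketB_comm z x, ketB_comm y x,
      f, g]
    match_scalars <;> field_simp <;> ring

/-- The multisets of letters with pairwise distinct rapidities taken from `U`. -/
def distinctKets (U : Set ℂ) : Set (Multiset Spec) :=
  {m | (m.map Spec.lam).Nodup ∧ ∀ s ∈ m, s.lam ∈ U}

/-- The span of the multisets with pairwise distinct rapidities taken from `U`. -/
abbrev KetsOn (U : Set ℂ) : Submodule ℂ Kets := Finsupp.supported ℂ ℂ (distinctKets U)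

theorem coe_mem_distinctKets {U : Set ℂ} {w : List Spec} :
    (w : Multiset Spec) ∈ distinctKets U ↔ w ∈ distinctWords U := by
  simp [distinctKets, distinctWords]

theorem toKet_mem {U : Set ℂ} {u : Words} (hu : u ∈ WordsOn U) : toKet u ∈ KetsOn U := by
  refine map_mem_of_mem_supported (fun w hw => ?_) hu
  rw [toKet_single]
  exact Finsupp.single_mem_supported ℂ _ (coe_mem_distinctKets.2 hw)

/-- The operator `𝔸(x)` on kets modulo the order of the letters. -/
def ketA (c : ℝ) (x : Spec) : Kets →ₗ[ℂ] Kets :=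
  Finsupp.linearCombination ℂ fun m => toKet (actA c x m.toList)

/-- The operator `𝔻(x)` on kets modulo the order of the letters. -/
def ketD (c : ℝ) (x : Spec) : Kets →ₗ[ℂ] Kets :=
  Finsupp.linearCombination ℂ fun m => toKet (actD c x m.toList)

/-- The operator `ℂ(x)` on kets modulo the order of the letters. -/
def ketC (c : ℝ) (x : Spec) : Kets →ₗ[ℂ] Kets :=
  Finsupp.linearCombination ℂ fun m => toKet (actC c x m.toList)

theorem nodup_cons_of_mem {U : Set ℂ} {x : Spec} {w : List Spec} (hx : x.lam ∉ U)
    (hw : w ∈ distinctWords U) : ((x :: w).map Spec.lam).Nodup :=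
  (cons_mem_distinctWords.2 ⟨Set.mem_insert _ _, by simpa [hx] using hw⟩ :
    x :: w ∈ distinctWords (insert x.lam U)).1

theorem coe_toList_perm (w : List Spec) : w.Perm (w : Multiset Spec).toList :=
  Multiset.coe_eq_coe.1 (Multiset.coe_toList _).symm

/-- This makes the arbitrary enumeration `m.toList` in `ketA` harmless: any ordering of the letters
gives the same ket, provided the rapidities are distinct and avoid that of `x`. -/
theorem toKet_actA (c : ℝ) {U : Set ℂ} {x : Spec} {w : List Spec} (hx : x.lam ∉ U)
    (hw : w ∈ distinctWords U) :
    toKet (actA c x w) = ketA c x (Finsupp.single (w : Multiset Spec) 1) := by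
  rw [ketA, Finsupp.linearCombination_single, one_smul,
    actA_perm c (coe_toList_perm w) x (nodup_cons_of_mem hx hw)]

theorem toKet_actD (c : ℝ) {U : Set ℂ} {x : Spec} {w : List Spec} (hx : x.lam ∉ U)
    (hw : w ∈ distinctWords U) :
    toKet (actD c x w) = ketD c x (Finsupp.single (w : Multiset Spec) 1) := by
  rw [ketD, Finsupp.linearCombination_single, one_smul,
    actD_perm c (coe_toList_perm w) x (nodup_cons_of_mem hx hw)]

theorem toKet_opA (c : ℝ) {U : Set ℂ} {x : Spec} (hx : x.lam ∉ U) {u : Words}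
    (hu : u ∈ WordsOn U) : toKet (opA c x u) = ketA c x (toKet u) :=
  eq_of_mem_supported (φ := toKet ∘ₗ opA c x) (ψ := ketA c x ∘ₗ toKet)
    (fun w hw => by simpa using toKet_actA c hx hw) hu

theorem exists_word (m : Multiset Spec) : ∃ w : List Spec, (w : Multiset Spec) = m :=
  Quot.exists_rep m

theorem ketA_mem (c : ℝ) {x : Spec} {U : Set ℂ} (hx : x.lam ∉ U) {u : Kets}
    (hu : u ∈ KetsOn U) : ketA c x u ∈ KetsOn (insert x.lam U) := by
  refine map_mem_of_mem_supported (fun m hm => ?_) hu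
  obtain ⟨w, rfl⟩ := exists_word m
  rw [coe_mem_distinctKets] at hm
  exact toKet_actA c hx hm ▸ toKet_mem (actA_mem c w x U hx hm)

theorem ketD_mem (c : ℝ) {x : Spec} {U : Set ℂ} (hx : x.lam ∉ U) {u : Kets}
    (hu : u ∈ KetsOn U) : ketD c x u ∈ KetsOn (insert x.lam U) := by
  refine map_mem_of_mem_supported (fun m hm => ?_) hu
  obtain ⟨w, rfl⟩ := exists_word m
  rw [coe_mem_distinctKets] at hm
  exact toKet_actD c hx hm ▸ toKet_mem (actD_mem c w x U hx hm)

theorem cons_mem_insert {U : Set ℂ} {x : Spec} {w : List Spec} (hx : x.lam ∉ U)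
    (hw : w ∈ distinctWords U) : x :: w ∈ distinctWords (insert x.lam U) :=
  cons_mem_distinctWords.2 ⟨Set.mem_insert _ _, by simpa [hx] using hw⟩

theorem ketA_ketB (c : ℝ) {x y : Spec} {U : Set ℂ} (hx : x.lam ∉ U) (hy : y.lam ∉ U)
    (hxy : x.lam ≠ y.lam) {u : Kets} (hu : u ∈ KetsOn U) :
    ketA c x (ketB y u) =
      f c x.lam y.lam • ketB y (ketA c x u) + g c y.lam x.lam • ketB x (ketA c y u) := by
  refine eq_of_mem_supported (φ := ketA c x ∘ₗ ketB y) (ψ := f c x.lam y.lam • ketB y ∘ₗ ketA c x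
    + g c y.lam x.lam • ketB x ∘ₗ ketA c y) (fun m hm => ?_) hu
  obtain ⟨w, rfl⟩ := exists_word m
  rw [coe_mem_distinctKets] at hm
  have hxU : x.lam ∉ insert y.lam U := by simp [hxy, hx]
  have := toKet_actA c hxU (cons_mem_insert hy hm)
  rw [actA] at this
  simpa [toKet_cons, toKet_actA c hx hm, toKet_actA c hy hm] using this.symm

theorem ketD_ketB (c : ℝ) {x y : Spec} {U : Set ℂ} (hx : x.lam ∉ U) (hy : y.lam ∉ U)
    (hxy : x.lam ≠ y.lam) {u : Kets} (hu : u ∈ KetsOn U) :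
    ketD c x (ketB y u) =
      f c y.lam x.lam • ketB y (ketD c x u) + g c x.lam y.lam • ketB x (ketD c y u) := by
  refine eq_of_mem_supported (φ := ketD c x ∘ₗ ketB y) (ψ := f c y.lam x.lam • ketB y ∘ₗ ketD c x
    + g c x.lam y.lam • ketB x ∘ₗ ketD c y) (fun m hm => ?_) hu
  obtain ⟨w, rfl⟩ := exists_word m
  rw [coe_mem_distinctKets] at hm
  have hxU : x.lam ∉ insert y.lam U := by simp [hxy, hx]
  have := toKet_actD c hxU (cons_mem_insert hy hm)
  rw [actD] at this
  simpa [toKet_cons, toKet_actD c hx hm, toKet_actD c hy hm] using this.symm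

theorem toKet_actC_cons (c : ℝ) {U : Set ℂ} {x y : Spec} {w : List Spec} (hx : x.lam ∉ U)
    (hy : y.lam ∉ U) (hxy : x.lam ≠ y.lam) (hw : w ∈ distinctWords U) :
    toKet (actC c x (y :: w)) = ketB y (toKet (actC c x w)) + g c x.lam y.lam •
      (ketA c x (ketD c y (Finsupp.single (w : Multiset Spec) 1)) -
        ketA c y (ketD c x (Finsupp.single (w : Multiset Spec) 1))) := by
  rw [actC, map_add, map_smul, map_sub, toKet_cons, toKet_opA c _ (actD_mem c w y U hy hw),
    toKet_opA c _ (actD_mem c w x U hx hw), toKet_actD c hx hw, toKet_actD c hy hw]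
  · simp [hxy.symm, hy]
  · simp [hxy, hx]

theorem actC_perm (c : ℝ) {w w' : List Spec} (h : w.Perm w') : ∀ x : Spec,
    ((x :: w).map Spec.lam).Nodup → toKet (actC c x w) = toKet (actC c x w') := by
  have key : ∀ {x : Spec} {w : List Spec}, ((x :: w).map Spec.lam).Nodup →
      x.lam ∉ {a | a ∈ w.map Spec.lam} ∧ w ∈ distinctWords {a | a ∈ w.map Spec.lam} := by
    intro x w hw
    rw [List.map_cons, List.nodup_cons] at hw
    exact ⟨hw.1, hw.2, fun s hs => List.mem_map_of_mem hs⟩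
  induction h with
  | nil => simp
  | trans h₁ _ ih₁ ih₂ =>
    intro x hx
    rw [ih₁ x hx, ih₂ x (((h₁.cons x).map _).nodup_iff.1 hx)]
  | @cons y w w' h ih =>
    intro x hx
    obtain ⟨hxU, hw⟩ := key (x := x) (w := w) (by grind)
    obtain ⟨hyU, -⟩ := key (x := y) (w := w) (by grind)
    have hxy : x.lam ≠ y.lam := by grind
    have hw' : w' ∈ distinctWords {a | a ∈ w.map Spec.lam} := by
      rwa [← coe_mem_distinctKets, ← Multiset.coe_eq_coe.2 h, coe_mem_distinctKets]
    rw [toKet_actC_cons c hxU hyU hxy hw, toKet_actC_cons c hxU hyU hxy hw', ih x (by grind),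
      Multiset.coe_eq_coe.2 h]
  | swap y z w =>
    intro x hx
    obtain ⟨hxU, hw⟩ := key (x := x) (w := w) (by grind)
    obtain ⟨hyU, -⟩ := key (x := y) (w := w) (by grind)
    obtain ⟨hzU, -⟩ := key (x := z) (w := w) (by grind)
    set U := {a | a ∈ w.map Spec.lam}
    have nxy : x.lam ≠ y.lam := by grind
    have nxz : x.lam ≠ z.lam := by grind
    have nyz : y.lam ≠ z.lam := by grind
    have hxy : x.lam - y.lam ≠ 0 := sub_ne_zero.2 nxy
    have hxz : x.lam - z.lam ≠ 0 := sub_ne_zero.2 nxz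
    have hyz : y.lam - z.lam ≠ 0 := sub_ne_zero.2 nyz
    have hyx : y.lam - x.lam ≠ 0 := sub_ne_zero.2 nxy.symm
    have hzx : z.lam - x.lam ≠ 0 := sub_ne_zero.2 nxz.symm
    have hzy : z.lam - y.lam ≠ 0 := sub_ne_zero.2 nyz.symm
    have hv : Finsupp.single (w : Multiset Spec) (1 : ℂ) ∈ KetsOn U :=
      Finsupp.single_mem_supported ℂ _ (coe_mem_distinctKets.2 hw)
    have hxU' : x.lam ∉ insert y.lam U := by simp [nxy, hxU]
    have hxU'' : x.lam ∉ insert z.lam U := by simp [nxz, hxU]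
    have hyU' : y.lam ∉ insert x.lam U := by simp [nxy.symm, hyU]
    have hyU'' : y.lam ∉ insert z.lam U := by simp [nyz, hyU]
    have hzU' : z.lam ∉ insert x.lam U := by simp [nxz.symm, hzU]
    have hzU'' : z.lam ∉ insert y.lam U := by simp [nyz.symm, hzU]
    rw [toKet_actC_cons c hxU' hzU'' nxz (cons_mem_insert hyU hw),
      toKet_actC_cons c hxU'' hyU'' nxy (cons_mem_insert hzU hw),
      toKet_actC_cons c hxU hyU nxy hw, toKet_actC_cons c hxU hzU nxz hw]
    -- The inner letter is moved out through `𝔻`, then through `𝔸`. Both sides become combinations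
    -- of the same terms, with letters `𝔹` in front of `𝔸𝔻` or `ℂ` acting on `w`, and coefficients
    -- are compared.
    simp only [← Multiset.cons_coe, ← ketB_single]
    rw [ketD_ketB c hzU hyU nyz.symm hv, ketD_ketB c hxU hyU nxy hv, ketD_ketB c hyU hzU nyz hv,
      ketD_ketB c hxU hzU nxz hv]
    simp only [map_add, map_sub, map_smul]
    rw [ketA_ketB c hxU'' hyU'' nxy (ketD_mem c hzU hv),
      ketA_ketB c hxU' hzU'' nxz (ketD_mem c hyU hv),
      ketA_ketB c hzU' hyU' nyz.symm (ketD_mem c hxU hv),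
      ketA_ketB c hyU' hzU' nyz (ketD_mem c hxU hv),
      ketA_ketB c hyU'' hxU'' nxy.symm (ketD_mem c hzU hv),
      ketA_ketB c hzU'' hxU' nxz.symm (ketD_mem c hyU hv)]
    simp only [ketB_comm z y, f, g]
    match_scalars <;> field_simp <;> ring

theorem toKet_actC (c : ℝ) {U : Set ℂ} {x : Spec} {w : List Spec} (hx : x.lam ∉ U)
    (hw : w ∈ distinctWords U) :
    toKet (actC c x w) = ketC c x (Finsupp.single (w : Multiset Spec) 1) := by
  rw [ketC, Finsupp.linearCombination_single, one_smul,
    actC_perm c (coe_toList_perm w) x (nodup_cons_of_mem hx hw)]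

theorem toKet_opC (c : ℝ) {U : Set ℂ} {x : Spec} (hx : x.lam ∉ U) {u : Words}
    (hu : u ∈ WordsOn U) : toKet (opC c x u) = ketC c x (toKet u) :=
  eq_of_mem_supported (φ := toKet ∘ₗ opC c x) (ψ := ketC c x ∘ₗ toKet)
    (fun w hw => by simpa using toKet_actC c hx hw) hu

theorem ketC_mem (c : ℝ) {x : Spec} {U : Set ℂ} (hx : x.lam ∉ U) {u : Kets}
    (hu : u ∈ KetsOn U) : ketC c x u ∈ KetsOn (insert x.lam U) := by
  refine map_mem_of_mem_supported (fun m hm => ?_) hu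
  obtain ⟨w, rfl⟩ := exists_word m
  rw [coe_mem_distinctKets] at hm
  exact toKet_actC c hx hm ▸ toKet_mem (actC_mem c w x U hx hm)

theorem ketC_ketB (c : ℝ) {x y : Spec} {U : Set ℂ} (hx : x.lam ∉ U) (hy : y.lam ∉ U)
    (hxy : x.lam ≠ y.lam) {u : Kets} (hu : u ∈ KetsOn U) :
    ketC c x (ketB y u) = ketB y (ketC c x u) +
      g c x.lam y.lam • (ketA c x (ketD c y u) - ketA c y (ketD c x u)) := by
  refine eq_of_mem_supported (φ := ketC c x ∘ₗ ketB y) (ψ := ketB y ∘ₗ ketC c x +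
    g c x.lam y.lam • (ketA c x ∘ₗ ketD c y - ketA c y ∘ₗ ketD c x)) (fun m hm => ?_) hu
  obtain ⟨w, rfl⟩ := exists_word m
  rw [coe_mem_distinctKets] at hm
  have hxU : x.lam ∉ insert y.lam U := by simp [hxy, hx]
  have := toKet_actC_cons c hx hy hxy hm
  rw [toKet_actC c hxU (cons_mem_insert hy hm), toKet_actC c hx hm] at this
  simpa using this

/-! ### Exchange relations among `𝔸`, `𝔻` and `ℂ` -/

@[simp] theorem ketA_vac (c : ℝ) (x : Spec) :
    ketA c x (Finsupp.single 0 1) = Finsupp.single 0 x.l := by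
  simp [ketA, actA]

@[simp] theorem ketD_vac (c : ℝ) (x : Spec) :
    ketD c x (Finsupp.single 0 1) = Finsupp.single 0 1 := by
  simp [ketD, actD]

@[simp] theorem ketC_vac (c : ℝ) (x : Spec) : ketC c x (Finsupp.single 0 1) = 0 := by
  simp [ketC, actC]

theorem single_zero_eq_smul (a : ℂ) :
    (Finsupp.single 0 a : Kets) = a • Finsupp.single 0 1 := by simp

/-- Induction on the number of letters for relations between operators with two parameters. -/
theorem ket_induction {φ ψ : Spec → Spec → Kets →ₗ[ℂ] Kets}
    (zero : ∀ x y : Spec, φ x y (Finsupp.single 0 1) = ψ x y (Finsupp.single 0 1))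
    (step : ∀ (U : Set ℂ) (t x y : Spec) (u : Kets), u ∈ KetsOn U →
      (∀ x y : Spec, x.lam ∉ U → y.lam ∉ U → x.lam ≠ y.lam → φ x y u = ψ x y u) →
      x.lam ∉ U → y.lam ∉ U → t.lam ∉ U → x.lam ≠ y.lam → x.lam ≠ t.lam → y.lam ≠ t.lam →
      φ x y (ketB t u) = ψ x y (ketB t u))
    {U : Set ℂ} {x y : Spec} (hx : x.lam ∉ U) (hy : y.lam ∉ U) (hxy : x.lam ≠ y.lam)
    {u : Kets} (hu : u ∈ KetsOn U) : φ x y u = ψ x y u := by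
  have key : ∀ (w : List Spec) (U : Set ℂ) (x y : Spec), w ∈ distinctWords U → x.lam ∉ U →
      y.lam ∉ U → x.lam ≠ y.lam → φ x y (Finsupp.single (w : Multiset Spec) 1) =
        ψ x y (Finsupp.single (w : Multiset Spec) 1) := by
    intro w
    induction w with
    | nil => exact fun U x y _ _ _ _ => zero x y
    | cons t w ih =>
      intro U x y hw hx hy hxy
      obtain ⟨ht, hw⟩ := cons_mem_distinctWords.1 hw
      rw [← Multiset.cons_coe, ← ketB_single]
      -- The induction hypothesis is supplied for all pairs of parameters, because passing `t` can
      -- exchange it with `x` or `y`.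
      exact step (U \ {t.lam}) t x y _
        (Finsupp.single_mem_supported ℂ _ (coe_mem_distinctKets.2 hw))
        (fun x y => ih _ x y hw) (fun h => hx h.1) (fun h => hy h.1) (by simp) hxy
        (fun h => hx (h ▸ ht)) (fun h => hy (h ▸ ht))
  refine eq_of_mem_supported (fun m hm => ?_) hu
  obtain ⟨w, rfl⟩ := exists_word m
  exact key w U x y (coe_mem_distinctKets.1 hm) hx hy hxy

theorem notMem_insert_of_ne {U : Set ℂ} {x y : ℂ} (hxy : x ≠ y) (hx : x ∉ U) :
    x ∉ insert y U := by simp [hxy, hx]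

/-- This relation and the five following it are consequences of the exchange rules with `𝔹` and the
action on the vacuum, by induction on the number of letters. They build up to the commutativity of
the `ℂ`: `ketC_ketA` and `ketC_ketD` rest on the relations among `𝔸` and `𝔻`, and `ketC_ketC` rests
on both. -/
theorem ketA_ketA (c : ℝ) {U : Set ℂ} {x y : Spec} (hx : x.lam ∉ U) (hy : y.lam ∉ U)
    (hxy : x.lam ≠ y.lam) {u : Kets} (hu : u ∈ KetsOn U) :
    ketA c x (ketA c y u) = ketA c y (ketA c x u) := by
  refine ket_induction (φ := fun x y => ketA c x ∘ₗ ketA c y)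
    (ψ := fun x y => ketA c y ∘ₗ ketA c x) (fun x y => ?_) ?_ hx hy hxy hu
  · simp only [LinearMap.comp_apply, ketA_vac, single_zero_eq_smul x.l, single_zero_eq_smul y.l,
      map_smul]
    exact smul_comm _ _ _
  · intro U t x y u hu ih hx hy ht hxy hxt hyt
    simp only [LinearMap.comp_apply] at ih ⊢
    have h₁ : x.lam - y.lam ≠ 0 := sub_ne_zero.2 hxy
    have h₂ : x.lam - t.lam ≠ 0 := sub_ne_zero.2 hxt
    have h₃ : y.lam - t.lam ≠ 0 := sub_ne_zero.2 hyt
    have h₄ : y.lam - x.lam ≠ 0 := sub_ne_zero.2 hxy.symm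
    have h₅ : t.lam - x.lam ≠ 0 := sub_ne_zero.2 hxt.symm
    have h₆ : t.lam - y.lam ≠ 0 := sub_ne_zero.2 hyt.symm
    have xy := notMem_insert_of_ne hxy hx
    have xt := notMem_insert_of_ne hxt hx
    have yx := notMem_insert_of_ne hxy.symm hy
    have yt := notMem_insert_of_ne hyt hy
    have tx := notMem_insert_of_ne hxt.symm ht
    have ty := notMem_insert_of_ne hyt.symm ht
    rw [ketA_ketB c hx ht hxt hu, ketA_ketB c hy ht hyt hu]
    simp only [map_add, map_smul]
    rw [ketA_ketB c xy ty hxt (ketA_mem c hy hu), ketA_ketB c xt yt hxy (ketA_mem c ht hu),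
      ketA_ketB c yx tx hyt (ketA_mem c hx hu), ketA_ketB c yt xt hxy.symm (ketA_mem c ht hu),
      ih y x hy hx hxy.symm, ih t y ht hy hyt.symm, ih t x ht hx hxt.symm]
    simp only [f, g]
    match_scalars <;> field_simp <;> ring

theorem ketD_ketD (c : ℝ) {U : Set ℂ} {x y : Spec} (hx : x.lam ∉ U) (hy : y.lam ∉ U)
    (hxy : x.lam ≠ y.lam) {u : Kets} (hu : u ∈ KetsOn U) :
    ketD c x (ketD c y u) = ketD c y (ketD c x u) := by
  refine ket_induction (φ := fun x y => ketD c x ∘ₗ ketD c y)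
    (ψ := fun x y => ketD c y ∘ₗ ketD c x) (fun x y => ?_) ?_ hx hy hxy hu
  · simp
  · intro U t x y u hu ih hx hy ht hxy hxt hyt
    simp only [LinearMap.comp_apply] at ih ⊢
    have h₁ : x.lam - y.lam ≠ 0 := sub_ne_zero.2 hxy
    have h₂ : x.lam - t.lam ≠ 0 := sub_ne_zero.2 hxt
    have h₃ : y.lam - t.lam ≠ 0 := sub_ne_zero.2 hyt
    have h₄ : y.lam - x.lam ≠ 0 := sub_ne_zero.2 hxy.symm
    have h₅ : t.lam - x.lam ≠ 0 := sub_ne_zero.2 hxt.symm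
    have h₆ : t.lam - y.lam ≠ 0 := sub_ne_zero.2 hyt.symm
    have xy := notMem_insert_of_ne hxy hx
    have xt := notMem_insert_of_ne hxt hx
    have yx := notMem_insert_of_ne hxy.symm hy
    have yt := notMem_insert_of_ne hyt hy
    have tx := notMem_insert_of_ne hxt.symm ht
    have ty := notMem_insert_of_ne hyt.symm ht
    rw [ketD_ketB c hx ht hxt hu, ketD_ketB c hy ht hyt hu]
    simp only [map_add, map_smul]
    rw [ketD_ketB c xy ty hxt (ketD_mem c hy hu), ketD_ketB c xt yt hxy (ketD_mem c ht hu),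
      ketD_ketB c yx tx hyt (ketD_mem c hx hu), ketD_ketB c yt xt hxy.symm (ketD_mem c ht hu),
      ih y x hy hx hxy.symm, ih t y ht hy hyt.symm, ih t x ht hx hxt.symm]
    simp only [f, g]
    match_scalars <;> field_simp <;> ring

theorem ketA_ketD (c : ℝ) {U : Set ℂ} {x y : Spec} (hx : x.lam ∉ U) (hy : y.lam ∉ U)
    (hxy : x.lam ≠ y.lam) {u : Kets} (hu : u ∈ KetsOn U) :
    ketA c x (ketD c y u) = ketD c y (ketA c x u) +
      g c x.lam y.lam • (ketB y (ketC c x u) - ketB x (ketC c y u)) := by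
  refine ket_induction (φ := fun x y => ketA c x ∘ₗ ketD c y)
    (ψ := fun x y => ketD c y ∘ₗ ketA c x +
      g c x.lam y.lam • (ketB y ∘ₗ ketC c x - ketB x ∘ₗ ketC c y)) (fun x y => ?_) ?_ hx hy hxy hu
  · simp only [LinearMap.comp_apply, LinearMap.add_apply, LinearMap.smul_apply,
      LinearMap.sub_apply, ketA_vac, ketD_vac, ketC_vac, single_zero_eq_smul x.l, map_smul,
      map_zero, sub_zero, smul_zero, add_zero]
  · intro U t x y u hu ih hx hy ht hxy hxt hyt
    simp only [LinearMap.comp_apply, LinearMap.add_apply, LinearMap.smul_apply,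
      LinearMap.sub_apply] at ih ⊢
    have h₁ : x.lam - y.lam ≠ 0 := sub_ne_zero.2 hxy
    have h₂ : x.lam - t.lam ≠ 0 := sub_ne_zero.2 hxt
    have h₃ : y.lam - t.lam ≠ 0 := sub_ne_zero.2 hyt
    have h₄ : y.lam - x.lam ≠ 0 := sub_ne_zero.2 hxy.symm
    have h₅ : t.lam - x.lam ≠ 0 := sub_ne_zero.2 hxt.symm
    have h₆ : t.lam - y.lam ≠ 0 := sub_ne_zero.2 hyt.symm
    have xy := notMem_insert_of_ne hxy hx
    have xt := notMem_insert_of_ne hxt hx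
    have yx := notMem_insert_of_ne hxy.symm hy
    have yt := notMem_insert_of_ne hyt hy
    have tx := notMem_insert_of_ne hxt.symm ht
    have ty := notMem_insert_of_ne hyt.symm ht
    rw [ketA_ketB c hx ht hxt hu, ketD_ketB c hy ht hyt hu, ketC_ketB c hx ht hxt hu,
      ketC_ketB c hy ht hyt hu]
    simp only [map_add, map_sub, map_smul]
    rw [ketA_ketB c xy ty hxt (ketD_mem c hy hu), ketA_ketB c xt yt hxy (ketD_mem c ht hu),
      ketD_ketB c yx tx hyt (ketA_mem c hx hu), ketD_ketB c yt xt hxy.symm (ketA_mem c ht hu),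
      ih x y hx hy hxy, ih t y ht hy hyt.symm, ih x t hx ht hxt, ih y t hy ht hyt,
      ih t x ht hx hxt.symm]
    simp only [map_add, map_sub, map_smul, ketB_comm x y, ketB_comm t y, ketB_comm t x, f, g]
    match_scalars <;> field_simp <;> ring

theorem ketC_ketA (c : ℝ) {U : Set ℂ} {x y : Spec} (hx : x.lam ∉ U) (hy : y.lam ∉ U)
    (hxy : x.lam ≠ y.lam) {u : Kets} (hu : u ∈ KetsOn U) :
    ketC c y (ketA c x u) = f c x.lam y.lam • ketA c x (ketC c y u) +
      g c y.lam x.lam • ketA c y (ketC c x u) := by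
  refine ket_induction (φ := fun x y => ketC c y ∘ₗ ketA c x)
    (ψ := fun x y => f c x.lam y.lam • ketA c x ∘ₗ ketC c y +
      g c y.lam x.lam • ketA c y ∘ₗ ketC c x) (fun x y => ?_) ?_ hx hy hxy hu
  · simp only [LinearMap.comp_apply, LinearMap.add_apply, LinearMap.smul_apply,
      ketA_vac, ketC_vac, single_zero_eq_smul x.l, map_smul,
      map_zero, smul_zero, add_zero]
  · intro U t x y u hu ih hx hy ht hxy hxt hyt
    simp only [LinearMap.comp_apply, LinearMap.add_apply, LinearMap.smul_apply] at ih ⊢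
    have h₁ : x.lam - y.lam ≠ 0 := sub_ne_zero.2 hxy
    have h₂ : x.lam - t.lam ≠ 0 := sub_ne_zero.2 hxt
    have h₃ : y.lam - t.lam ≠ 0 := sub_ne_zero.2 hyt
    have h₄ : y.lam - x.lam ≠ 0 := sub_ne_zero.2 hxy.symm
    have h₅ : t.lam - x.lam ≠ 0 := sub_ne_zero.2 hxt.symm
    have h₆ : t.lam - y.lam ≠ 0 := sub_ne_zero.2 hyt.symm
    have xy := notMem_insert_of_ne hxy hx
    have xt := notMem_insert_of_ne hxt hx
    have yx := notMem_insert_of_ne hxy.symm hy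
    have yt := notMem_insert_of_ne hyt hy
    have tx := notMem_insert_of_ne hxt.symm ht
    have ty := notMem_insert_of_ne hyt.symm ht
    -- Used to put `𝔸` to the left of `𝔻` throughout, so that both sides expand in the same
    -- monomials.
    have da : ∀ {x y : Spec}, x.lam ∉ U → y.lam ∉ U → x.lam ≠ y.lam →
        ketD c y (ketA c x u) = ketA c x (ketD c y u) -
          g c x.lam y.lam • (ketB y (ketC c x u) - ketB x (ketC c y u)) := fun hx hy hxy => by
      rw [ketA_ketD c hx hy hxy hu, add_sub_cancel_right]
    rw [ketA_ketB c hx ht hxt hu, ketC_ketB c hx ht hxt hu, ketC_ketB c hy ht hyt hu]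
    simp only [map_add, map_sub, map_smul]
    rw [ketC_ketB c yx tx hyt (ketA_mem c hx hu), ketC_ketB c yt xt hxy.symm (ketA_mem c ht hu),
      ketA_ketB c xy ty hxt (ketC_mem c hy hu), ketA_ketB c yx tx hyt (ketC_mem c hx hu),
      da hx ht hxt, da hx hy hxy, da ht hx hxt.symm, da ht hy hyt.symm]
    simp only [map_sub, map_smul]
    rw [ketA_ketB c yt xt hxy.symm (ketC_mem c ht hu),
      ketA_ketB c tx yx hyt.symm (ketC_mem c hx hu), ketA_ketB c ty xy hxt.symm (ketC_mem c hy hu),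
      ketA_ketB c xt yt hxy (ketC_mem c ht hu), ketA_ketB c xy ty hxt (ketC_mem c hy hu),
      ketA_ketB c yx tx hyt (ketC_mem c hx hu),
      ketA_ketA c yt xt hxy.symm (ketD_mem c ht hu), ketA_ketA c ty xy hxt.symm (ketD_mem c hy hu),
      ih x y hx hy hxy, ih t y ht hy hyt.symm]
    simp only [map_add, map_smul, f, g]
    match_scalars <;> field_simp <;> ring

theorem ketC_ketD (c : ℝ) {U : Set ℂ} {x y : Spec} (hx : x.lam ∉ U) (hy : y.lam ∉ U)
    (hxy : x.lam ≠ y.lam) {u : Kets} (hu : u ∈ KetsOn U) :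
    ketC c y (ketD c x u) = f c y.lam x.lam • ketD c x (ketC c y u) +
      g c x.lam y.lam • ketD c y (ketC c x u) := by
  refine ket_induction (φ := fun x y => ketC c y ∘ₗ ketD c x)
    (ψ := fun x y => f c y.lam x.lam • ketD c x ∘ₗ ketC c y +
      g c x.lam y.lam • ketD c y ∘ₗ ketC c x) (fun x y => ?_) ?_ hx hy hxy hu
  · simp
  · intro U t x y u hu ih hx hy ht hxy hxt hyt
    simp only [LinearMap.comp_apply, LinearMap.add_apply, LinearMap.smul_apply] at ih ⊢
    have h₁ : x.lam - y.lam ≠ 0 := sub_ne_zero.2 hxy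
    have h₂ : x.lam - t.lam ≠ 0 := sub_ne_zero.2 hxt
    have h₃ : y.lam - t.lam ≠ 0 := sub_ne_zero.2 hyt
    have h₄ : y.lam - x.lam ≠ 0 := sub_ne_zero.2 hxy.symm
    have h₅ : t.lam - x.lam ≠ 0 := sub_ne_zero.2 hxt.symm
    have h₆ : t.lam - y.lam ≠ 0 := sub_ne_zero.2 hyt.symm
    have xy := notMem_insert_of_ne hxy hx
    have xt := notMem_insert_of_ne hxt hx
    have yx := notMem_insert_of_ne hxy.symm hy
    have yt := notMem_insert_of_ne hyt hy
    have tx := notMem_insert_of_ne hxt.symm ht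
    have ty := notMem_insert_of_ne hyt.symm ht
    have da : ∀ {V : Set ℂ} {v : Kets} {x y : Spec}, x.lam ∉ V → y.lam ∉ V → x.lam ≠ y.lam →
        v ∈ KetsOn V → ketD c y (ketA c x v) = ketA c x (ketD c y v) -
          g c x.lam y.lam • (ketB y (ketC c x v) - ketB x (ketC c y v)) := fun hx hy hxy hv => by
      rw [ketA_ketD c hx hy hxy hv, add_sub_cancel_right]
    rw [ketD_ketB c hx ht hxt hu, ketC_ketB c hx ht hxt hu, ketC_ketB c hy ht hyt hu]
    simp only [map_add, map_sub, map_smul]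
    rw [ketC_ketB c yx tx hyt (ketD_mem c hx hu), ketC_ketB c yt xt hxy.symm (ketD_mem c ht hu),
      ketD_ketB c xy ty hxt (ketC_mem c hy hu), ketD_ketB c yx tx hyt (ketC_mem c hx hu),
      da yt xt hxy.symm (ketD_mem c ht hu), da ty xy hxt.symm (ketD_mem c hy hu),
      da xt yt hxy (ketD_mem c ht hu), da tx yx hyt.symm (ketD_mem c hx hu),
      ketD_ketD c hy hx hxy.symm hu, ketD_ketD c ht hx hxt.symm hu,
      ih x y hx hy hxy, ih t y ht hy hyt.symm, ih t x ht hx hxt.symm, ih y x hy hx hxy.symm,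
      ih y t hy ht hyt, ih x t hx ht hxt]
    simp only [map_add, map_smul, f, g]
    match_scalars <;> field_simp <;> ring

/-- Passing a letter `t` leaves terms `ℂ𝔸𝔻`; the two preceding relations carry `ℂ` through them to
the right, and the terms without `t` then cancel. -/
theorem ketC_ketC (c : ℝ) {U : Set ℂ} {x y : Spec} (hx : x.lam ∉ U) (hy : y.lam ∉ U)
    (hxy : x.lam ≠ y.lam) {u : Kets} (hu : u ∈ KetsOn U) :
    ketC c x (ketC c y u) = ketC c y (ketC c x u) := by
  refine ket_induction (φ := fun x y => ketC c x ∘ₗ ketC c y)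
    (ψ := fun x y => ketC c y ∘ₗ ketC c x) (fun x y => ?_) ?_ hx hy hxy hu
  · simp
  · intro U t x y u hu ih hx hy ht hxy hxt hyt
    simp only [LinearMap.comp_apply] at ih ⊢
    have h₁ : x.lam - y.lam ≠ 0 := sub_ne_zero.2 hxy
    have h₂ : x.lam - t.lam ≠ 0 := sub_ne_zero.2 hxt
    have h₃ : y.lam - t.lam ≠ 0 := sub_ne_zero.2 hyt
    have h₄ : y.lam - x.lam ≠ 0 := sub_ne_zero.2 hxy.symm
    have h₅ : t.lam - x.lam ≠ 0 := sub_ne_zero.2 hxt.symm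
    have h₆ : t.lam - y.lam ≠ 0 := sub_ne_zero.2 hyt.symm
    have xy := notMem_insert_of_ne hxy hx
    have xt := notMem_insert_of_ne hxt hx
    have yx := notMem_insert_of_ne hxy.symm hy
    have yt := notMem_insert_of_ne hyt hy
    have tx := notMem_insert_of_ne hxt.symm ht
    have ty := notMem_insert_of_ne hyt.symm ht
    rw [ketC_ketB c hx ht hxt hu, ketC_ketB c hy ht hyt hu]
    simp only [map_add, map_sub, map_smul]
    rw [ketC_ketB c xy ty hxt (ketC_mem c hy hu), ketC_ketB c yx tx hyt (ketC_mem c hx hu),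
      ketC_ketA c yt xt hxy.symm (ketD_mem c ht hu), ketC_ketA c ty xy hxt.symm (ketD_mem c hy hu),
      ketC_ketA c xt yt hxy (ketD_mem c ht hu), ketC_ketA c tx yx hyt.symm (ketD_mem c hx hu),
      ketC_ketD c hx hy hxy hu, ketC_ketD c ht hy hyt.symm hu, ketC_ketD c ht hx hxt.symm hu,
      ketC_ketD c hy hx hxy.symm hu, ketC_ketD c hy ht hyt hu, ketC_ketD c hx ht hxt hu,
      ih y x hy hx hxy.symm]
    simp only [map_add, map_smul, f, g]
    match_scalars <;> field_simp <;> ring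

/-! ### Independence of the order of the operators in a bra -/

theorem toKet_apply_zero (u : Words) : toKet u 0 = u [] := by
  have : Finsupp.lapply 0 ∘ₗ toKet = (Finsupp.lapply [] : Words →ₗ[ℂ] ℂ) := by
    ext w
    cases w <;> simp
  exact LinearMap.congr_fun this u

theorem toKet_foldl_opC (c : ℝ) (w : List Spec) {V : Set ℂ} {v : Words} (hv : v ∈ WordsOn V)
    (hw : (w.map Spec.lam).Nodup) (hwV : ∀ s ∈ w, s.lam ∉ V) :
    toKet (w.foldl (fun u x => opC c x u) v) = w.foldl (fun u x => ketC c x u) (toKet v) := by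
  induction w generalizing v V with
  | nil => rfl
  | cons x w ih =>
    have hx : x.lam ∉ V := hwV x (by simp)
    rw [List.foldl_cons, List.foldl_cons, ← toKet_opC c hx hv]
    exact ih (opC_mem c hx hv) (by grind) (by simp; grind)

theorem foldl_ketC_perm (c : ℝ) {w w' : List Spec} (h : w.Perm w') {V : Set ℂ} {v : Kets}
    (hv : v ∈ KetsOn V) (hw : (w.map Spec.lam).Nodup) (hwV : ∀ s ∈ w, s.lam ∉ V) :
    w.foldl (fun u x => ketC c x u) v = w'.foldl (fun u x => ketC c x u) v := by
  induction h generalizing v V with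
  | nil => rfl
  | cons x _ ih =>
    exact ih (ketC_mem c (hwV x (by simp)) hv) (by grind) (by simp; grind)
  | swap x y w =>
    simp only [List.foldl_cons]
    rw [ketC_ketC c (hwV x (by simp)) (hwV y (by simp)) (by grind) hv]
  | trans h₁ _ ih₁ ih₂ =>
    rw [ih₁ hv hw hwV, ih₂ hv ((h₁.map _).nodup_iff.1 hw) fun s hs => hwV s (h₁.mem_iff.2 hs)]

theorem braWord_perm (c : ℝ) {w w' : List Spec} (h : w.Perm w') {V : Set ℂ} {v : Words}
    (hv : v ∈ WordsOn V) (hw : (w.map Spec.lam).Nodup) (hwV : ∀ s ∈ w, s.lam ∉ V) :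
    braWord c w v = braWord c w' v := by
  rw [braWord, braWord, ← toKet_apply_zero, ← toKet_apply_zero, toKet_foldl_opC c w hv hw hwV,
    toKet_foldl_opC c w' hv ((h.map _).nodup_iff.1 hw) fun s hs => hwV s (h.mem_iff.2 hs),
    foldl_ketC_perm c h (toKet_mem hv) hw hwV]

/-- The pairing with a fixed ket as a linear functional on bras. -/
def pairingWith (c : ℝ) (v : Words) : Words →ₗ[ℂ] ℂ :=
  Finsupp.linearCombination ℂ fun w => braWord c w v

theorem pairing_eq (c : ℝ) (φ v : Words) : pairing c φ v = pairingWith c v φ := by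
  simp [pairing, pairingWith, Finsupp.linearCombination_apply]

@[simp] theorem pairingWith_single (c : ℝ) (v : Words) (w : List Spec) :
    pairingWith c v (Finsupp.single w 1) = braWord c w v := by
  simp [pairingWith]

/-- Since the `ℂ` commute, the pairing with `v` factors through `toKet`. Disjointness of `U` and `V`
keeps the rapidities of the `ℂ` away from those of the ket they act on. -/
theorem pairing_congr (c : ℝ) {U V : Set ℂ} (hUV : Disjoint U V) {φ φ' v : Words}
    (hφ : φ ∈ WordsOn U) (hφ' : φ' ∈ WordsOn U) (hv : v ∈ WordsOn V)
    (h : toKet φ = toKet φ') : pairing c φ v = pairing c φ' v := by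
  have key : ∀ {φ : Words}, φ ∈ WordsOn U → pairingWith c v φ =
      Finsupp.linearCombination ℂ (fun m : Multiset Spec => braWord c m.toList v) (toKet φ) := by
    intro φ hφ
    refine eq_of_mem_supported (φ := pairingWith c v) (ψ := Finsupp.linearCombination ℂ
      (fun m : Multiset Spec => braWord c m.toList v) ∘ₗ toKet) (fun w hw => ?_) hφ
    simpa using braWord_perm c (coe_toList_perm w) hv hw.1
      fun s hs => Set.disjoint_left.1 hUV (hw.2 s hs)
  rw [pairing_eq, pairing_eq, key hφ, key hφ', h]

theorem braPsiDag_perm (c : ℝ) {w w' : List Spec} (h : w.Perm w')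
    (hw : (w.map Spec.lam).Nodup) : toKet (braPsiDag c w) = toKet (braPsiDag c w') := by
  induction h with
  | nil => rfl
  | trans h₁ _ ih₁ ih₂ => rw [ih₁ hw, ih₂ ((h₁.map _).nodup_iff.1 hw)]
  | cons y h ih =>
    simp only [braPsiDag, braD_eq_actD, map_add, map_smul, toKet_cons, ih (by grind),
      actD_perm c h y hw]
  | swap y z w =>
    have hyz : y.lam - z.lam ≠ 0 := sub_ne_zero.2 (by grind)
    have hzy : z.lam - y.lam ≠ 0 := sub_ne_zero.2 (by grind)
    simp only [braPsiDag, braD_eq_actD, actD, map_add, map_smul, toKet_cons, ketB_comm z y, f, g]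
    match_scalars <;> field_simp

/-- Right multiplication by `Ψ†` on bras modulo the order of the letters. -/
def ketPsiDag (c : ℝ) : Kets →ₗ[ℂ] Kets :=
  Finsupp.linearCombination ℂ fun m => toKet (braPsiDag c m.toList)

theorem toKet_opPsiDag (c : ℝ) {U : Set ℂ} {u : Words} (hu : u ∈ WordsOn U) :
    toKet (opPsiDag c u) = ketPsiDag c (toKet u) := by
  refine eq_of_mem_supported (φ := toKet ∘ₗ opPsiDag c) (ψ := ketPsiDag c ∘ₗ toKet)
    (fun w hw => ?_) hu
  simpa [ketPsiDag] using braPsiDag_perm c (coe_toList_perm w) hw.1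

theorem opPsi_iterate_mem (c : ℝ) (k : ℕ) {U : Set ℂ} {u : Words} (hu : u ∈ WordsOn U) :
    (opPsi c)^[k] u ∈ WordsOn U := by
  induction k with
  | zero => exact hu
  | succ k ih => rw [Function.iterate_succ_apply']; exact opPsi_mem c ih

theorem opPsiDag_iterate_mem (c : ℝ) (k : ℕ) {U : Set ℂ} {u : Words} (hu : u ∈ WordsOn U) :
    (opPsiDag c)^[k] u ∈ WordsOn U := by
  induction k with
  | zero => exact hu
  | succ k ih => rw [Function.iterate_succ_apply']; exact opPsiDag_mem c ih

theorem toKet_opPsiDag_iterate (c : ℝ) (k : ℕ) {U : Set ℂ} {u : Words} (hu : u ∈ WordsOn U) :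
    toKet ((opPsiDag c)^[k] u) = (ketPsiDag c)^[k] (toKet u) := by
  induction k with
  | zero => rfl
  | succ k ih =>
    rw [Function.iterate_succ_apply', Function.iterate_succ_apply',
      toKet_opPsiDag c (opPsiDag_iterate_mem c k hu), ih]

/-- The matrix elements of `(Ψ†)ᵏΨᵏ` do not depend on the order of the operators in the bra. -/
theorem pairing_perm (c : ℝ) (k : ℕ) {w w' v : List Spec} (h : w.Perm w')
    (hw : (w.map Spec.lam).Nodup) (hv : (v.map Spec.lam).Nodup)
    (hwv : ∀ s ∈ w, ∀ t ∈ v, s.lam ≠ t.lam) :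
    pairing c ((opPsiDag c)^[k] (Finsupp.single w 1)) ((opPsi c)^[k] (Finsupp.single v 1)) =
      pairing c ((opPsiDag c)^[k] (Finsupp.single w' 1))
        ((opPsi c)^[k] (Finsupp.single v 1)) := by
  have hw₁ : (Finsupp.single w 1 : Words) ∈ WordsOn {a | a ∈ w.map Spec.lam} :=
    single_mem_wordsOn ⟨hw, fun s hs => List.mem_map_of_mem hs⟩
  have hw₂ : (Finsupp.single w' 1 : Words) ∈ WordsOn {a | a ∈ w.map Spec.lam} :=
    single_mem_wordsOn ⟨(h.map _).nodup_iff.1 hw,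
      fun s hs => List.mem_map_of_mem (h.mem_iff.2 hs)⟩
  have hv₁ : (Finsupp.single v 1 : Words) ∈ WordsOn {a | a ∈ v.map Spec.lam} :=
    single_mem_wordsOn ⟨hv, fun s hs => List.mem_map_of_mem hs⟩
  refine pairing_congr c ?_ (opPsiDag_iterate_mem c k hw₁) (opPsiDag_iterate_mem c k hw₂)
    (opPsi_iterate_mem c k hv₁) ?_
  · refine Set.disjoint_left.2 fun a ha hb => ?_
    obtain ⟨s, hs, rfl⟩ := List.mem_map.1 ha
    obtain ⟨t, ht, hst⟩ := List.mem_map.1 hb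
    exact hwv s hs t ht hst.symm
  · rw [toKet_opPsiDag_iterate c k hw₁, toKet_opPsiDag_iterate c k hw₂, toKet_single,
      toKet_single, Multiset.coe_eq_coe.2 h]

/-! ### Families of vectors -/

/-- The words over `U ∪ {e}` in which `e` occurs at most once, and only as the last letter. -/
inductive Tail {α : Type*} (U : Set α) (e : α) : List α → Prop
  | nil : Tail U e []
  | last : Tail U e [e]
  | cons {x : α} {w : List α} : x ∈ U → Tail U e w → Tail U e (x :: w)

/-- The value at `t` of a word whose letters are functions. -/
def evalWord {T : Type*} (W : List (T → Spec)) (t : T) : List Spec := W.map fun s => s t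

@[simp] theorem evalWord_nil {T : Type*} (t : T) : evalWord [] t = [] := rfl

@[simp] theorem evalWord_cons {T : Type*} (s : T → Spec) (W : List (T → Spec)) (t : T) :
    evalWord (s :: W) t = s t :: evalWord W t := rfl

section Families

variable {T : Type*} {c : ℝ} {𝒜 : Subalgebra ℂ (T → ℂ)} {U : Set (T → Spec)} {e : T → Spec}

/-- The families of vectors which are combinations with coefficients in `𝒜` of words over
`U ∪ {e}` with `e` at most at the end. -/
inductive Reg (𝒜 : Subalgebra ℂ (T → ℂ)) (U : Set (T → Spec)) (e : T → Spec) :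
    (T → Words) → Prop
  | word {W : List (T → Spec)} : Tail U e W → Reg 𝒜 U e fun t => Finsupp.single (evalWord W t) 1
  | zero : Reg 𝒜 U e fun _ => 0
  | add {u v : T → Words} : Reg 𝒜 U e u → Reg 𝒜 U e v → Reg 𝒜 U e fun t => u t + v t
  | smul {a : T → ℂ} {u : T → Words} : a ∈ 𝒜 → Reg 𝒜 U e u → Reg 𝒜 U e fun t => a t • u t

theorem const_mem (𝒜 : Subalgebra ℂ (T → ℂ)) (a : ℂ) : (fun _ => a) ∈ 𝒜 := 𝒜.algebraMap_mem a

theorem Reg.sub {u v : T → Words} (hu : Reg 𝒜 U e u) (hv : Reg 𝒜 U e v) :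
    Reg 𝒜 U e fun t => u t - v t := by
  have := hu.add (hv.smul (const_mem 𝒜 (-1)))
  simpa [sub_eq_add_neg] using this

theorem Reg.map {U' : Set (T → Spec)} {e' : T → Spec} {O : T → Words →ₗ[ℂ] Words}
    (h : ∀ W, Tail U e W → Reg 𝒜 U' e' fun t => O t (Finsupp.single (evalWord W t) 1))
    {u : T → Words} (hu : Reg 𝒜 U e u) : Reg 𝒜 U' e' fun t => O t (u t) := by
  induction hu with
  | word hW => exact h _ hW
  | zero => simpa using Reg.zero
  | add _ _ ih₁ ih₂ => simpa using ih₁.add ih₂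
  | smul ha _ ih => simpa using ih.smul ha

theorem Reg.eq {N : Type*} [AddCommGroup N] [Module ℂ N] {t : T} {φ ψ : Words →ₗ[ℂ] N}
    (h : ∀ W, Tail U e W → φ (Finsupp.single (evalWord W t) 1) =
      ψ (Finsupp.single (evalWord W t) 1))
    {u : T → Words} (hu : Reg 𝒜 U e u) : φ (u t) = ψ (u t) := by
  induction hu with
  | word hW => exact h _ hW
  | zero => simp
  | add _ _ ih₁ ih₂ => simp [ih₁, ih₂]
  | smul _ _ ih => simp [ih]

theorem Reg.apply_nil {u : T → Words} (hu : Reg 𝒜 U e u) : (fun t => u t []) ∈ 𝒜 := by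
  induction hu with
  | @word W _ =>
    cases W with
    | nil => simpa using const_mem 𝒜 1
    | cons s W => simpa using const_mem 𝒜 0
  | zero => simpa using const_mem 𝒜 0
  | add _ _ ih₁ ih₂ => exact 𝒜.add_mem ih₁ ih₂
  | smul ha _ ih => exact 𝒜.mul_mem ha ih

theorem Reg.cons {x : T → Spec} (hx : x ∈ U) {u : T → Words} (hu : Reg 𝒜 U e u) :
    Reg 𝒜 U e fun t => cons (x t) (u t) := by
  refine Reg.map (O := fun t => BoseGas.cons (x t)) (fun W hW => ?_) hu
  simpa using Reg.word (hW.cons hx)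

/-- The structure functions of the letters in `U ∪ {e}` belong to `𝒜`. -/
structure Coeffs (c : ℝ) (𝒜 : Subalgebra ℂ (T → ℂ)) (U : Set (T → Spec)) (e : T → Spec) :
    Prop where
  f_mem : ∀ s ∈ insert e U, ∀ s' ∈ insert e U, (fun t => f c (s t).lam (s' t).lam) ∈ 𝒜
  g_mem : ∀ s ∈ insert e U, ∀ s' ∈ insert e U, (fun t => g c (s t).lam (s' t).lam) ∈ 𝒜
  l_mem : ∀ s ∈ insert e U, (fun t => (s t).l) ∈ 𝒜

theorem Reg.vac {a : T → ℂ} (ha : a ∈ 𝒜) :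
    Reg 𝒜 U e fun t => Finsupp.single [] (a t) := by
  simpa using (Reg.word (𝒜 := 𝒜) (Tail.nil (U := U) (e := e))).smul ha

/-- Passing a letter of `U` puts that letter or `x` in front, both in `U`. At the end of the word
`e` either stays last or becomes the argument of `𝔸(e)|0⟩` and disappears, so it never leaves the
last place. -/
theorem Coeffs.actA (h : Coeffs c 𝒜 U e) {W : List (T → Spec)} (hW : Tail U e W) :
    ∀ x ∈ U, Reg 𝒜 U e fun t => actA c (x t) (evalWord W t) := by
  induction hW with
  | nil => exact fun x hx => Reg.vac (h.l_mem x (.inr hx))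
  | last =>
    intro x hx
    refine Reg.add (.smul (h.f_mem x (.inr hx) e (.inl rfl)) ?_)
      (.smul (h.g_mem e (.inl rfl) x (.inr hx)) ?_)
    · simpa [BoseGas.actA] using
        (Reg.word (𝒜 := 𝒜) (Tail.last (U := U) (e := e))).smul (h.l_mem x (.inr hx))
    · exact (Reg.vac (h.l_mem e (.inl rfl))).cons hx
  | @cons y w hy _ ih =>
    exact fun x hx => ((ih x hx).cons hy |>.smul (h.f_mem x (.inr hx) y (.inr hy))).add
      ((ih y hy).cons hx |>.smul (h.g_mem y (.inr hy) x (.inr hx)))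

theorem Coeffs.actD (h : Coeffs c 𝒜 U e) {W : List (T → Spec)} (hW : Tail U e W) :
    ∀ x ∈ U, Reg 𝒜 U e fun t => actD c (x t) (evalWord W t) := by
  induction hW with
  | nil => exact fun x hx => Reg.vac (const_mem 𝒜 1)
  | last =>
    intro x hx
    refine Reg.add (.smul (h.f_mem e (.inl rfl) x (.inr hx)) ?_)
      (.smul (h.g_mem x (.inr hx) e (.inl rfl)) ?_)
    · simpa [BoseGas.actD] using Reg.word (𝒜 := 𝒜) (Tail.last (U := U) (e := e))
    · exact (Reg.vac (const_mem 𝒜 1)).cons hx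
  | @cons y w hy _ ih =>
    exact fun x hx => ((ih x hx).cons hy |>.smul (h.f_mem y (.inr hy) x (.inr hx))).add
      ((ih y hy).cons hx |>.smul (h.g_mem x (.inr hx) y (.inr hy)))

theorem Coeffs.opA (h : Coeffs c 𝒜 U e) {x : T → Spec} (hx : x ∈ U) {u : T → Words}
    (hu : Reg 𝒜 U e u) : Reg 𝒜 U e fun t => opA c (x t) (u t) :=
  Reg.map (O := fun t => BoseGas.opA c (x t)) (fun W hW => by simpa using h.actA hW x hx) hu

theorem Coeffs.opC (h : Coeffs c 𝒜 U e) {x : T → Spec} (hx : x ∈ U) {u : T → Words}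
    (hu : Reg 𝒜 U e u) : Reg 𝒜 U e fun t => opC c (x t) (u t) := by
  refine Reg.map (O := fun t => BoseGas.opC c (x t)) (fun W hW => ?_) hu
  simp only [opC_single]
  induction hW with
  | nil => exact Reg.zero
  | last =>
    have := Reg.vac (U := U) (e := e) (𝒜.mul_mem (h.g_mem x (.inr hx) e (.inl rfl))
      (𝒜.sub_mem (h.l_mem x (.inr hx)) (h.l_mem e (.inl rfl))))
    simpa [BoseGas.actC, BoseGas.actD, BoseGas.actA, ← Finsupp.single_sub] using this
  | @cons y w hy hw ih =>
    exact (ih.cons hy).add (.smul (h.g_mem x (.inr hx) y (.inr hy))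
      ((h.opA hx (h.actD hw y hy)).sub (h.opA hy (h.actD hw x hx))))

theorem Coeffs.opPsi (h : Coeffs c 𝒜 U e) {u : T → Words} (hu : Reg 𝒜 U e u) :
    Reg 𝒜 U e fun t => opPsi c (u t) := by
  refine Reg.map (O := fun _ => BoseGas.opPsi c) (fun W hW => ?_) hu
  simp only [opPsi_single]
  induction hW with
  | nil => exact Reg.zero
  | last =>
    have := (Reg.vac (U := U) (e := e) (h.l_mem e (.inl rfl))).smul
      (const_mem 𝒜 (-Complex.I * sqrtC c))
    simpa [actPsi, BoseGas.actA] using this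
  | @cons y w hy hw ih => exact (ih.cons hy).add (.smul (const_mem 𝒜 _) (h.actA hw y hy))

theorem Coeffs.opPsiDag (h : Coeffs c 𝒜 U e) {u : T → Words} (hu : Reg 𝒜 U e u) :
    Reg 𝒜 U e fun t => opPsiDag c (u t) := by
  refine Reg.map (O := fun _ => BoseGas.opPsiDag c) (fun W hW => ?_) hu
  simp only [opPsiDag_single]
  induction hW with
  | nil => exact Reg.zero
  | last =>
    have := (Reg.vac (𝒜 := 𝒜) (U := U) (e := e) (const_mem 𝒜 1)).smul
      (const_mem 𝒜 (Complex.I * sqrtC c))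
    simpa [braPsiDag, braD] using this
  | @cons y w hy hw ih =>
    simp only [evalWord_cons, braPsiDag, braD_eq_actD]
    exact (ih.cons hy).add (.smul (const_mem 𝒜 _) (h.actD hw y hy))

theorem Coeffs.opPsi_iterate (h : Coeffs c 𝒜 U e) (k : ℕ) {u : T → Words} (hu : Reg 𝒜 U e u) :
    Reg 𝒜 U e fun t => (BoseGas.opPsi c)^[k] (u t) := by
  induction k with
  | zero => exact hu
  | succ k ih => simpa only [Function.iterate_succ_apply'] using h.opPsi ih

theorem Coeffs.opPsiDag_iterate (h : Coeffs c 𝒜 U e) (k : ℕ) {u : T → Words}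
    (hu : Reg 𝒜 U e u) : Reg 𝒜 U e fun t => (BoseGas.opPsiDag c)^[k] (u t) := by
  induction k with
  | zero => exact hu
  | succ k ih => simpa only [Function.iterate_succ_apply'] using h.opPsiDag ih

end Families

/-! ### Removing the letter closest to the vacuum -/

section Strip

theorem opA_cons (c : ℝ) (x y : Spec) (u : Words) : opA c x (cons y u) =
    f c x.lam y.lam • cons y (opA c x u) + g c y.lam x.lam • cons x (opA c y u) := by
  have : opA c x ∘ₗ cons y =
      f c x.lam y.lam • cons y ∘ₗ opA c x + g c y.lam x.lam • cons x ∘ₗ opA c y := by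
    ext1 w
    ext1
    simp [actA]
  exact LinearMap.congr_fun this u

theorem opD_cons (c : ℝ) (x y : Spec) (u : Words) : opD c x (cons y u) =
    f c y.lam x.lam • cons y (opD c x u) + g c x.lam y.lam • cons x (opD c y u) := by
  have : opD c x ∘ₗ cons y =
      f c y.lam x.lam • cons y ∘ₗ opD c x + g c x.lam y.lam • cons x ∘ₗ opD c y := by
    ext1 w
    ext1
    simp [actD]
  exact LinearMap.congr_fun this u

theorem opC_cons (c : ℝ) (x y : Spec) (u : Words) : opC c x (cons y u) = cons y (opC c x u) +
    g c x.lam y.lam • (opA c x (opD c y u) - opA c y (opD c x u)) := by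
  have : opC c x ∘ₗ cons y = cons y ∘ₗ opC c x +
      g c x.lam y.lam • (opA c x ∘ₗ opD c y - opA c y ∘ₗ opD c x) := by
    ext1 w
    ext1
    simp [actC]
  exact LinearMap.congr_fun this u

theorem opPsi_cons (c : ℝ) (y : Spec) (u : Words) : opPsi c (cons y u) = cons y (opPsi c u) +
    (-Complex.I * sqrtC c) • opA c y u := by
  have : opPsi c ∘ₗ cons y = cons y ∘ₗ opPsi c + (-Complex.I * sqrtC c) • opA c y := by
    ext1 w
    ext1
    simp [actPsi]
  exact LinearMap.congr_fun this u

theorem opPsiDag_cons (c : ℝ) (y : Spec) (u : Words) :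
    opPsiDag c (cons y u) = cons y (opPsiDag c u) + (Complex.I * sqrtC c) • opD c y u := by
  have : opPsiDag c ∘ₗ cons y = cons y ∘ₗ opPsiDag c + (Complex.I * sqrtC c) • opD c y := by
    ext1 w
    ext1
    simp [braPsiDag, braD_eq_actD]
  exact LinearMap.congr_fun this u

/-- The change of the variable `l` of a letter when a letter with rapidity `b` is removed. -/
def shift (c : ℝ) (b : ℂ) (s : Spec) : Spec := ⟨s.lam, s.l * (f c s.lam b / f c b s.lam)⟩

@[simp] theorem shift_lam (c : ℝ) (b : ℂ) (s : Spec) : (shift c b s).lam = s.lam := rfl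

open Classical in
/-- Remove the last letter of a word if it is `e`; words without the letter `e` are mapped
to zero. -/
def strip (c : ℝ) (b : ℂ) (e : Spec) : List Spec → Words
  | [] => 0
  | s :: w => if s = e then Finsupp.single [] 1
      else f c b s.lam • cons (shift c b s) (strip c b e w)

/-- The linear extension of `strip`. -/
def opStrip (c : ℝ) (b : ℂ) (e : Spec) : Words →ₗ[ℂ] Words :=
  Finsupp.linearCombination ℂ (strip c b e)

variable {c : ℝ} {b : ℂ}

@[simp] theorem opStrip_single (e : Spec) (w : List Spec) (a : ℂ) :
    opStrip c b e (Finsupp.single w a) = a • strip c b e w := by simp [opStrip]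

theorem strip_cons {e s : Spec} (h : s ≠ e) (w : List Spec) :
    strip c b e (s :: w) = f c b s.lam • cons (shift c b s) (strip c b e w) := by
  rw [strip, if_neg h]

@[simp] theorem strip_self (e : Spec) (w : List Spec) :
    strip c b e (e :: w) = Finsupp.single [] 1 := by
  rw [strip, if_pos rfl]

@[simp] theorem strip_nil (e : Spec) : strip c b e [] = 0 := rfl

theorem opStrip_cons {e s : Spec} (h : s ≠ e) (u : Words) :
    opStrip c b e (cons s u) = f c b s.lam • cons (shift c b s) (opStrip c b e u) := by
  have : opStrip c b e ∘ₗ cons s = f c b s.lam • cons (shift c b s) ∘ₗ opStrip c b e := by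
    ext1 w
    ext1
    simp [strip_cons h]
  exact LinearMap.congr_fun this u

theorem strip_append {e : Spec} {w : List Spec} (h : ∀ s ∈ w, s ≠ e) :
    strip c b e (w ++ [e]) =
      (w.map fun s => f c b s.lam).prod • Finsupp.single (w.map (shift c b)) 1 := by
  induction w with
  | nil => simp
  | cons s w ih =>
    rw [List.cons_append, strip_cons (h s (by simp)), ih fun s hs => h s (by simp [hs])]
    simp

variable {T : Type*} {𝒜 : Subalgebra ℂ (T → ℂ)} {U : Set (T → Spec)} {e : T → Spec} {t : T}

/-- At the vacuum end the term keeping `e` is `f(x,b) l(x) 𝔹(e)|0⟩`; the other term has lost `e` and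
is stripped to zero. Writing `f(x,b) l(x)` as `f(b,x)` times a new `l` is what dictates `shift`.
When another letter `y` is passed, both terms carry the same weight `f(b,x) f(b,y)`, so the relation
propagates. -/
theorem opStrip_actA (he : (e t).lam = b) (hU : ∀ s ∈ U, s t ≠ e t ∧ f c b (s t).lam ≠ 0)
    {W : List (T → Spec)} (hW : Tail U e W) : ∀ x ∈ U,
    opStrip c b (e t) (actA c (x t) (evalWord W t)) =
      f c b (x t).lam • opA c (shift c b (x t)) (strip c b (e t) (evalWord W t)) := by
  induction hW with
  | nil => simp [actA]
  | last =>
    intro x hx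
    obtain ⟨h₁, h₂⟩ := hU x hx
    simp [actA, shift, strip_cons h₁, he, -Finsupp.single_mul]
    field_simp
  | cons hy _ ih =>
    intro x hx
    rw [evalWord_cons, actA, map_add, map_smul, map_smul, opStrip_cons (hU _ hy).1,
      opStrip_cons (hU x hx).1, ih x hx, ih _ hy, strip_cons (hU _ hy).1]
    simp only [map_smul, opA_cons, shift_lam]
    module

/-- Here the exchange of `𝔻(x)` with `𝔹(e)` yields `f(b,x)` directly, with no change of `l`. This is
why `f(b,s)` is the weight of a letter in `strip`. -/
theorem opStrip_actD (he : (e t).lam = b) (hU : ∀ s ∈ U, s t ≠ e t ∧ f c b (s t).lam ≠ 0)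
    {W : List (T → Spec)} (hW : Tail U e W) : ∀ x ∈ U,
    opStrip c b (e t) (actD c (x t) (evalWord W t)) =
      f c b (x t).lam • opD c (shift c b (x t)) (strip c b (e t) (evalWord W t)) := by
  induction hW with
  | nil => simp [actD]
  | last =>
    intro x hx
    simp [actD, strip_cons (hU x hx).1, he]
  | cons hy _ ih =>
    intro x hx
    rw [evalWord_cons, actD, map_add, map_smul, map_smul, opStrip_cons (hU _ hy).1,
      opStrip_cons (hU x hx).1, ih x hx, ih _ hy, strip_cons (hU _ hy).1]
    simp only [map_smul, opD_cons, shift_lam]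
    module

theorem opStrip_opA (he : (e t).lam = b) (hU : ∀ s ∈ U, s t ≠ e t ∧ f c b (s t).lam ≠ 0)
    {x : T → Spec} (hx : x ∈ U) {u : T → Words} (hu : Reg 𝒜 U e u) :
    opStrip c b (e t) (opA c (x t) (u t)) =
      f c b (x t).lam • opA c (shift c b (x t)) (opStrip c b (e t) (u t)) :=
  Reg.eq (φ := opStrip c b (e t) ∘ₗ opA c (x t))
    (ψ := f c b (x t).lam • opA c (shift c b (x t)) ∘ₗ opStrip c b (e t))
    (fun W hW => by simpa using opStrip_actA he hU hW x hx) hu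

/-- The `𝔸𝔻` terms pick up `f(b,x) f(b,y)`, one factor from each operator; `f(b,y)` is the weight of
the letter `y`, which leaves `f(b,x)` in front. -/
theorem opStrip_opC (h : Coeffs c 𝒜 U e) (he : (e t).lam = b)
    (hU : ∀ s ∈ U, s t ≠ e t ∧ f c b (s t).lam ≠ 0)
    {x : T → Spec} (hx : x ∈ U) {u : T → Words} (hu : Reg 𝒜 U e u) :
    opStrip c b (e t) (opC c (x t) (u t)) =
      f c b (x t).lam • opC c (shift c b (x t)) (opStrip c b (e t) (u t)) := by
  refine Reg.eq (φ := opStrip c b (e t) ∘ₗ opC c (x t))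
    (ψ := f c b (x t).lam • opC c (shift c b (x t)) ∘ₗ opStrip c b (e t)) (fun W hW => ?_) hu
  simp only [LinearMap.comp_apply, LinearMap.smul_apply, opC_single, opStrip_single, one_smul]
  induction hW with
  | nil => simp [actC]
  | last => simp [actC, actD, actA]
  | @cons y w hy hw ih =>
    rw [evalWord_cons, actC, map_add, map_smul, map_sub, opStrip_cons (hU _ hy).1, ih,
      opStrip_opA he hU hx (h.actD hw y hy), opStrip_opA he hU hy (h.actD hw x hx),
      opStrip_actD he hU hw x hx, opStrip_actD he hU hw y hy, strip_cons (hU _ hy).1]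
    simp only [map_smul, opC_cons, shift_lam]
    module

/-- No factor remains: the `f(b,y)` produced by `𝔸(y)` is exactly the weight of the letter `y` that
it replaces. -/
theorem opStrip_opPsi (he : (e t).lam = b) (hU : ∀ s ∈ U, s t ≠ e t ∧ f c b (s t).lam ≠ 0)
    {u : T → Words} (hu : Reg 𝒜 U e u) :
    opStrip c b (e t) (opPsi c (u t)) = opPsi c (opStrip c b (e t) (u t)) := by
  refine Reg.eq (φ := opStrip c b (e t) ∘ₗ opPsi c) (ψ := opPsi c ∘ₗ opStrip c b (e t))
    (fun W hW => ?_) hu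
  simp only [LinearMap.comp_apply, opPsi_single, opStrip_single, one_smul]
  induction hW with
  | nil => simp [actPsi]
  | last => simp [actPsi, actA, -Finsupp.single_mul]
  | @cons y w hy hw ih =>
    rw [evalWord_cons, actPsi, map_add, map_smul, opStrip_cons (hU _ hy).1, ih,
      opStrip_actA he hU hw y hy, strip_cons (hU _ hy).1, map_smul, opPsi_cons]
    module

theorem opStrip_opPsiDag (he : (e t).lam = b) (hU : ∀ s ∈ U, s t ≠ e t ∧ f c b (s t).lam ≠ 0)
    {u : T → Words} (hu : Reg 𝒜 U e u) :
    opStrip c b (e t) (opPsiDag c (u t)) = opPsiDag c (opStrip c b (e t) (u t)) := by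
  refine Reg.eq (φ := opStrip c b (e t) ∘ₗ opPsiDag c) (ψ := opPsiDag c ∘ₗ opStrip c b (e t))
    (fun W hW => ?_) hu
  simp only [LinearMap.comp_apply, opPsiDag_single, opStrip_single, one_smul]
  induction hW with
  | nil => simp [braPsiDag]
  | last => simp [braPsiDag, braD, -Finsupp.single_mul]
  | @cons y w hy hw ih =>
    rw [evalWord_cons, braPsiDag, braD_eq_actD, map_add, map_smul, opStrip_cons (hU _ hy).1, ih,
      opStrip_actD he hU hw y hy, strip_cons (hU _ hy).1, map_smul, opPsiDag_cons]
    module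

theorem opStrip_opPsi_iterate (h : Coeffs c 𝒜 U e) (he : (e t).lam = b)
    (hU : ∀ s ∈ U, s t ≠ e t ∧ f c b (s t).lam ≠ 0) (k : ℕ) {u : T → Words}
    (hu : Reg 𝒜 U e u) :
    opStrip c b (e t) ((opPsi c)^[k] (u t)) = (opPsi c)^[k] (opStrip c b (e t) (u t)) := by
  induction k with
  | zero => rfl
  | succ k ih =>
    rw [Function.iterate_succ_apply', Function.iterate_succ_apply',
      opStrip_opPsi he hU (h.opPsi_iterate k hu), ih]

theorem opStrip_opPsiDag_iterate (h : Coeffs c 𝒜 U e) (he : (e t).lam = b)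
    (hU : ∀ s ∈ U, s t ≠ e t ∧ f c b (s t).lam ≠ 0) (k : ℕ) {u : T → Words}
    (hu : Reg 𝒜 U e u) :
    opStrip c b (e t) ((opPsiDag c)^[k] (u t)) =
      (opPsiDag c)^[k] (opStrip c b (e t) (u t)) := by
  induction k with
  | zero => rfl
  | succ k ih =>
    rw [Function.iterate_succ_apply', Function.iterate_succ_apply',
      opStrip_opPsiDag he hU (h.opPsiDag_iterate k hu), ih]

/-- The family of letters with shifted variables `l`. -/
def shiftSet (c : ℝ) (b : ℂ) (U : Set (T → Spec)) : Set (T → Spec) :=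
  (fun s t => shift c b (s t)) '' U

theorem Reg.strip (hf : ∀ s ∈ U, (fun t => f c b (s t).lam) ∈ 𝒜)
    (hU : ∀ s ∈ U, ∀ t, s t ≠ e t) {u : T → Words} (hu : Reg 𝒜 U e u) (e' : T → Spec) :
    Reg 𝒜 (shiftSet c b U) e' fun t => opStrip c b (e t) (u t) := by
  refine Reg.map (O := fun t => opStrip c b (e t)) (fun W hW => ?_) hu
  simp only [opStrip_single, one_smul]
  induction hW with
  | nil => exact .zero
  | last => simpa using Reg.vac (const_mem 𝒜 1)
  | @cons y w hy hw ih =>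
    simp only [evalWord_cons, strip_cons (hU y hy _)]
    exact (ih.cons (Set.mem_image_of_mem _ hy)).smul (hf y hy)

end Strip

/-! ### The singular part of a pairing -/

theorem cons_apply_nil (x : Spec) (u : Words) : cons x u [] = 0 := by
  have : Finsupp.lapply [] ∘ₗ cons x = (0 : Words →ₗ[ℂ] ℂ) := by
    ext w
    simp
  exact LinearMap.congr_fun this u

theorem opA_apply_nil (c : ℝ) (x : Spec) (u : Words) : opA c x u [] = x.l * u [] := by
  have : Finsupp.lapply [] ∘ₗ opA c x = x.l • (Finsupp.lapply [] : Words →ₗ[ℂ] ℂ) := by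
    ext w
    cases w <;> simp [actA, cons_apply_nil]
  exact LinearMap.congr_fun this u

/-- `ℂ` removes one letter from a word, so the vacuum is reached only from a one-letter word. -/
theorem opC_cons_apply_nil (c : ℝ) (x y : Spec) (w : List Spec) :
    opC c x (Finsupp.single (y :: w) 1) [] =
      g c x.lam y.lam * ((x.l - y.l) * (Finsupp.single w (1 : ℂ) : Words) []) := by
  cases w <;> simp [actC, actD, actA, cons_apply_nil, opA_apply_nil]

theorem foldl_opC_smul (c : ℝ) (w : List Spec) (a : ℂ) (v : Words) :
    w.foldl (fun u x => opC c x u) (a • v) = a • w.foldl (fun u x => opC c x u) v := by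
  induction w generalizing v with
  | nil => rfl
  | cons x w ih => simp [ih]

theorem pairingWith_smul (c : ℝ) (a : ℂ) (v φ : Words) :
    pairingWith c (a • v) φ = a * pairingWith c v φ := by
  have : pairingWith c (a • v) = a • pairingWith c v := by
    ext w
    simp [braWord, foldl_opC_smul]
  exact LinearMap.congr_fun this φ

theorem pairingWith_cons (c : ℝ) (s : Spec) (v φ : Words) :
    pairingWith c v (cons s φ) = pairingWith c (opC c s v) φ := by
  have : pairingWith c v ∘ₗ cons s = pairingWith c (opC c s v) := by
    ext w
    simp [braWord]
  exact LinearMap.congr_fun this φ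

section Residue

variable {T : Type*} {c : ℝ} {b : ℂ} {𝒜 : Subalgebra ℂ (T → ℂ)} {U X : Set (T → Spec)}
  {β Z : T → Spec}

/-- Among one-letter words, `[β]` gives the singular `g(Z,b)`, while `[s]` with `s ∈ U` has its
coefficient in `𝒜`. The empty-word coefficient of the stripped vector is nonzero on `[β]` only,
hence it isolates the singular term. -/
theorem opC_apply_nil_residue (hU : Coeffs c 𝒜 U β) (hβ : ∀ t, (β t).lam = b)
    (hβU : ∀ s ∈ U, ∀ t, s t ≠ β t) (hg : ∀ s ∈ U, (fun t => g c (Z t).lam (s t).lam) ∈ 𝒜)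
    (hl : (fun t => (Z t).l) ∈ 𝒜) {u : T → Words} (hu : Reg 𝒜 U β u) :
    ∃ H ∈ 𝒜, ∀ t, opC c (Z t) (u t) [] =
      g c (Z t).lam b * ((Z t).l - (β t).l) * opStrip c b (β t) (u t) [] + H t := by
  induction hu with
  | word hW =>
    cases hW with
    | nil => exact ⟨_, const_mem 𝒜 0, fun t => by simp [actC]⟩
    | last => exact ⟨_, const_mem 𝒜 0, fun t => by
        beta_reduce
        rw [evalWord_cons, opC_cons_apply_nil, hβ]
        simp⟩
    | @cons s W hs hW =>
      refine ⟨_, 𝒜.mul_mem (hg s hs) (𝒜.mul_mem (𝒜.sub_mem hl (hU.l_mem s (.inr hs)))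
        (Reg.apply_nil (.word hW))), fun t => ?_⟩
      beta_reduce
      rw [evalWord_cons, opC_cons_apply_nil, opStrip_single, strip_cons (hβU s hs t)]
      simp [cons_apply_nil]
  | zero => exact ⟨_, const_mem 𝒜 0, fun t => by simp⟩
  | add _ _ ih₁ ih₂ =>
    obtain ⟨H₁, h₁, e₁⟩ := ih₁
    obtain ⟨H₂, h₂, e₂⟩ := ih₂
    refine ⟨_, 𝒜.add_mem h₁ h₂, fun t => ?_⟩
    rw [map_add, map_add, Finsupp.add_apply, Finsupp.add_apply, e₁, e₂, Pi.add_apply]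
    ring
  | @smul a _ ha _ ih =>
    obtain ⟨H, h, e⟩ := ih
    refine ⟨_, 𝒜.mul_mem ha h, fun t => ?_⟩
    rw [map_smul, map_smul, Finsupp.smul_apply, Finsupp.smul_apply, e, Pi.mul_apply, smul_eq_mul,
      smul_eq_mul]
    ring

/-- The operators `ℂ(x)` preceding `ℂ(Z)` keep the ket regular, so singularity arises only at the
last step. Commuting the stripping back through each `ℂ(x)` produces `f(b,x)` and the shifted
letter, the very data by which `strip` acts on the bra word. -/
theorem braWord_residue (hU : Coeffs c 𝒜 U β)
    (hXU : X ⊆ U) (hβ : ∀ t, (β t).lam = b)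
    (hβU : ∀ s ∈ U, ∀ t, s t ≠ β t ∧ f c b (s t).lam ≠ 0)
    (hg : ∀ s ∈ U, (fun t => g c (Z t).lam (s t).lam) ∈ 𝒜) (hl : (fun t => (Z t).l) ∈ 𝒜)
    (t₀ : T) (hXZ : ∀ s ∈ X, s t₀ ≠ Z t₀) {W : List (T → Spec)} (hW : Tail X Z W) :
    ∀ {v : T → Words}, Reg 𝒜 U β v → ∃ E ∈ 𝒜, ∃ H ∈ 𝒜,
      (∀ t, braWord c (evalWord W t) (v t) =
        g c (Z t).lam b * ((Z t).l - (β t).l) * E t + H t) ∧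
      E t₀ = pairingWith c (opStrip c b (β t₀) (v t₀))
        (strip c b (Z t₀) (evalWord W t₀)) := by
  have hf : ∀ s ∈ U, (fun t => f c b (s t).lam) ∈ 𝒜 := fun s hs => by
    simpa only [hβ] using hU.f_mem β (.inl rfl) s (.inr hs)
  have hne : ∀ s ∈ U, ∀ t, s t ≠ β t := fun s hs t => (hβU s hs t).1
  induction hW with
  | nil =>
    intro v hv
    -- A bra word that has lost `Z` has no singular part, in agreement with its being stripped to
    -- zero.
    exact ⟨_, const_mem 𝒜 0, _, hv.apply_nil, fun t => by simp [braWord], by simp⟩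
  | last =>
    intro v hv
    obtain ⟨H, hH, e⟩ := opC_apply_nil_residue hU hβ hne hg hl hv
    exact ⟨_, (hv.strip hf hne β).apply_nil, H, hH, fun t => by simp [braWord, e],
      by simp [braWord]⟩
  | @cons x W hx hW ih =>
    intro v hv
    obtain ⟨E, hE, H, hH, e, e₀⟩ := ih (hU.opC (hXU hx) hv)
    refine ⟨E, hE, H, hH, fun t => by rw [← e]; simp [braWord], ?_⟩
    rw [e₀, opStrip_opC hU (hβ t₀) (fun s hs => hβU s hs t₀) (hXU hx) hv, evalWord_cons,
      strip_cons (hXZ x hx), map_smul, pairingWith_cons, pairingWith_smul, smul_eq_mul]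

/-- The singular part of the pairing of a bra containing `ℂ(Z)` with a ket containing `𝔹(β)`. -/
theorem pairing_residue (hU : Coeffs c 𝒜 U β)
    (hXU : X ⊆ U) (hβ : ∀ t, (β t).lam = b)
    (hβU : ∀ s ∈ U, ∀ t, s t ≠ β t ∧ f c b (s t).lam ≠ 0)
    (hg : ∀ s ∈ U, (fun t => g c (Z t).lam (s t).lam) ∈ 𝒜) (hl : (fun t => (Z t).l) ∈ 𝒜)
    (t₀ : T) (hXZ : ∀ s ∈ X, s t₀ ≠ Z t₀) {φ v : T → Words} (hφ : Reg 𝒜 X Z φ)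
    (hv : Reg 𝒜 U β v) :
    ∃ E ∈ 𝒜, ∃ H ∈ 𝒜, (∀ t, pairing c (φ t) (v t) =
        g c (Z t).lam b * ((Z t).l - (β t).l) * E t + H t) ∧
      E t₀ = pairing c (opStrip c b (Z t₀) (φ t₀)) (opStrip c b (β t₀) (v t₀)) := by
  simp only [pairing_eq]
  induction hφ with
  | word hW =>
    simpa using braWord_residue hU hXU hβ hβU hg hl t₀ hXZ hW hv
  | zero => exact ⟨_, const_mem 𝒜 0, _, const_mem 𝒜 0, fun t => by simp, by simp⟩
  | add _ _ ih₁ ih₂ =>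
    obtain ⟨E₁, hE₁, H₁, h₁, e₁, f₁⟩ := ih₁
    obtain ⟨E₂, hE₂, H₂, h₂, e₂, f₂⟩ := ih₂
    refine ⟨_, 𝒜.add_mem hE₁ hE₂, _, 𝒜.add_mem h₁ h₂, fun t => ?_, ?_⟩
    · rw [map_add, e₁, e₂, Pi.add_apply, Pi.add_apply]
      ring
    · rw [map_add, map_add, Pi.add_apply, f₁, f₂]
  | @smul a _ ha _ ih =>
    obtain ⟨E, hE, H, h, e, f⟩ := ih
    refine ⟨_, 𝒜.mul_mem ha hE, _, 𝒜.mul_mem ha h, fun t => ?_, ?_⟩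
    · rw [map_smul, e, Pi.mul_apply, Pi.mul_apply, smul_eq_mul]
      ring
    · rw [map_smul, map_smul, Pi.mul_apply, f, smul_eq_mul]

end Residue

/-! ### Analyticity of the structure functions -/

/-- The functions which are analytic at `b`. -/
def analyticFunctions (b : ℂ) : Subalgebra ℂ (ℂ → ℂ) where
  carrier := {a | AnalyticAt ℂ a b}
  mul_mem' := AnalyticAt.mul
  add_mem' := AnalyticAt.add
  algebraMap_mem' _ := analyticAt_const

theorem analyticAt_f (c : ℝ) {u v : ℂ → ℂ} {b : ℂ} (hu : AnalyticAt ℂ u b)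
    (hv : AnalyticAt ℂ v b) (h : u b ≠ v b) : AnalyticAt ℂ (fun z => f c (u z) (v z)) b :=
  ((hu.sub hv).add analyticAt_const).div (hu.sub hv) (sub_ne_zero.2 h)

theorem analyticAt_g (c : ℝ) {u v : ℂ → ℂ} {b : ℂ} (hu : AnalyticAt ℂ u b)
    (hv : AnalyticAt ℂ v b) (h : u b ≠ v b) : AnalyticAt ℂ (fun z => g c (u z) (v z)) b :=
  analyticAt_const.div (hu.sub hv) (sub_ne_zero.2 h)

/-- Letters with constant rapidities `p i`. -/
def letters {ι T : Type*} (p : ι → ℂ) (l : ι → T → ℂ) : ι → T → Spec := fun i t => ⟨p i, l i t⟩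

theorem coeffs_letters {ι : Type*} (c : ℝ) {b : ℂ} {p : ι → ℂ} {l : ι → ℂ → ℂ}
    (hl : ∀ i, AnalyticAt ℂ (l i) b) {e : ℂ → Spec}
    (he : AnalyticAt ℂ (fun z => (e z).lam) b) (hel : AnalyticAt ℂ (fun z => (e z).l) b)
    (hpe : ∀ i, p i ≠ (e b).lam) :
    Coeffs c (analyticFunctions b) (Set.range (letters p l)) e where
  f_mem := by
    rintro s (rfl | ⟨i, rfl⟩) s' (rfl | ⟨j, rfl⟩)
    -- At equal arguments division by zero makes `f` vanish, so the pair `(e, e)` contributes a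
    -- constant.
    · simpa [f] using const_mem (analyticFunctions b) 0
    · exact analyticAt_f c he analyticAt_const (hpe j).symm
    · exact analyticAt_f c analyticAt_const he (hpe i)
    · exact const_mem (analyticFunctions b) (f c (p i) (p j))
  g_mem := by
    rintro s (rfl | ⟨i, rfl⟩) s' (rfl | ⟨j, rfl⟩)
    · simpa [g] using const_mem (analyticFunctions b) 0
    · exact analyticAt_g c he analyticAt_const (hpe j).symm
    · exact analyticAt_g c analyticAt_const he (hpe i)
    · exact const_mem (analyticFunctions b) (g c (p i) (p j))
  l_mem := by
    rintro s (rfl | ⟨i, rfl⟩)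
    · exact hel
    · exact hl i

/-! ### The Bethe equations -/

theorem S_sub (c : ℝ) {u v : ℂ} (h : u ≠ v) : S c (u - v) = f c v u / f c u v := by
  have h₁ : u - v ≠ 0 := sub_ne_zero.2 h
  have h₂ : v - u ≠ 0 := sub_ne_zero.2 h.symm
  rw [S, f, f, div_div_div_eq, ← neg_sub u v, neg_mul,
    show (-(u - v) + Complex.I * c) * (u - v) = -((u - v - Complex.I * c) * (u - v)) by ring,
    neg_div_neg_eq, mul_comm (u - v) (u - v + _), mul_div_mul_right _ _ h₁]

theorem prod_erase_eq_prod_ite {ι : Type*} [Fintype ι] [DecidableEq ι] (j : ι) (F : ι → ℂ) :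
    ∏ k ∈ Finset.univ.erase j, F k = ∏ k, if k = j then 1 else F k := by
  rw [← Finset.prod_erase Finset.univ (f := fun k => if k = j then 1 else F k) (if_pos rfl)]
  exact Finset.prod_congr rfl fun k hk => (if_neg (Finset.ne_of_mem_erase hk)).symm

theorem betheL_snoc_castSucc (c : ℝ) {n : ℕ} (x : Fin n → ℂ) (z : ℂ) (i : Fin n) :
    betheL c (Fin.snoc x z : Fin (n + 1) → ℂ) i.castSucc =
      betheL c x i * (S c (z - x i))⁻¹ := by
  rw [betheL, betheL, prod_erase_eq_prod_ite, prod_erase_eq_prod_ite, Fin.prod_univ_castSucc,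
    mul_inv]
  have h : Fin.last n ≠ i.castSucc := (Fin.castSucc_lt_last i).ne'
  simp [h]

theorem betheL_snoc_last (c : ℝ) {n : ℕ} (x : Fin n → ℂ) (z : ℂ) :
    betheL c (Fin.snoc x z : Fin (n + 1) → ℂ) (Fin.last n) = ∏ k, (S c (x k - z))⁻¹ := by
  rw [betheL, prod_erase_eq_prod_ite, Fin.prod_univ_castSucc]
  have h : ∀ i : Fin n, i.castSucc ≠ Fin.last n := fun i => (Fin.castSucc_lt_last i).ne
  simp [h]

theorem analyticAt_inv_S (c : ℝ) {u : ℂ → ℂ} {b : ℂ} (hu : AnalyticAt ℂ u b)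
    (h₁ : u b ≠ Complex.I * c) (h₂ : -u b ≠ Complex.I * c) :
    AnalyticAt ℂ (fun z => (S c (u z))⁻¹) b := by
  have h₃ : u b - Complex.I * c ≠ 0 := sub_ne_zero.2 h₁
  have h₄ : u b + Complex.I * c ≠ 0 := fun h => h₂ (by linear_combination -h)
  exact ((hu.sub analyticAt_const).div (hu.add analyticAt_const) h₄).inv (div_ne_zero h₃ h₄)

theorem f_ne_zero (c : ℝ) {u v : ℂ} (h : u ≠ v) (h' : v - u ≠ Complex.I * c) :
    f c u v ≠ 0 :=
  div_ne_zero (fun h₀ => h' (by linear_combination -h₀)) (sub_ne_zero.2 h)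

/-- Adjoining `b` divides the Bethe value at `x i` by `S(b - x i) = f(x i, b)/f(b, x i)`, and
`shift` multiplies by this same ratio. -/
theorem shift_betheL (c : ℝ) {n : ℕ} {x : Fin n → ℂ} {b : ℂ} {i : Fin n} (h : x i ≠ b)
    (h₁ : x i - b ≠ Complex.I * c) (h₂ : b - x i ≠ Complex.I * c) :
    shift c b ⟨x i, betheL c (Fin.snoc x b : Fin (n + 1) → ℂ) i.castSucc⟩ =
      ⟨x i, betheL c x i⟩ := by
  have h₃ := f_ne_zero c h h₂
  have h₄ := f_ne_zero c h.symm h₁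
  rw [shift, betheL_snoc_castSucc, S_sub c h.symm]
  congr 1
  field_simp

theorem betheL_snoc_last_mul (c : ℝ) {n : ℕ} {x : Fin n → ℂ} {b : ℂ} (h : ∀ i, x i ≠ b)
    (h₁ : ∀ i, x i - b ≠ Complex.I * c) (h₂ : ∀ i, b - x i ≠ Complex.I * c) :
    betheL c (Fin.snoc x b : Fin (n + 1) → ℂ) (Fin.last n) * ∏ i, f c b (x i) =
      ∏ i, f c (x i) b := by
  rw [betheL_snoc_last, ← Finset.prod_mul_distrib]
  refine Finset.prod_congr rfl fun i _ => ?_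
  have h₃ := f_ne_zero c (h i) (h₂ i)
  have h₄ := f_ne_zero c (h i).symm (h₁ i)
  rw [S_sub c (h i)]
  field_simp

/-! ### Words -/

theorem tail_append {α : Type*} {U : Set α} {e : α} {w : List α} (h : ∀ s ∈ w, s ∈ U) :
    Tail U e (w ++ [e]) := by
  induction w with
  | nil => exact .last
  | cons s w ih => exact .cons (h s (by simp)) (ih fun t ht => h t (by simp [ht]))

theorem evalWord_append {T : Type*} (V W : List (T → Spec)) (t : T) :
    evalWord (V ++ W) t = evalWord V t ++ evalWord W t := List.map_append

theorem evalWord_letters {T : Type*} {n : ℕ} (p : Fin n → ℂ) (l : Fin n → T → ℂ) (t : T) :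
    evalWord (List.ofFn (letters p l)) t = word p fun i => l i t := by
  rw [evalWord, List.map_ofFn]
  rfl

theorem evalWord_reverse {T : Type*} (W : List (T → Spec)) (t : T) :
    evalWord W.reverse t = (evalWord W t).reverse := List.map_reverse

theorem word_snoc {n : ℕ} (x : Fin n → ℂ) (z : ℂ) (l : Fin (n + 1) → ℂ) :
    word (Fin.snoc x z : Fin (n + 1) → ℂ) l =
      word x (fun i => l i.castSucc) ++ [⟨z, l (Fin.last n)⟩] := by
  simp [word, List.ofFn_succ_last, -List.ofFn_succ]

theorem map_lam_word {n : ℕ} (x l : Fin n → ℂ) : (word x l).map Spec.lam = List.ofFn x := by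
  rw [word, List.map_ofFn]
  rfl

theorem mem_word {n : ℕ} {x l : Fin n → ℂ} {s : Spec} (h : s ∈ word x l) : ∃ i, s = ⟨x i, l i⟩ := by
  obtain ⟨i, rfl⟩ := List.mem_ofFn.1 h
  exact ⟨i, rfl⟩

theorem map_shift_word {n : ℕ} (c : ℝ) {x : Fin n → ℂ} {b : ℂ} (h : ∀ i, x i ≠ b)
    (h₁ : ∀ i, x i - b ≠ Complex.I * c) (h₂ : ∀ i, b - x i ≠ Complex.I * c) :
    (word x fun i => betheL c (Fin.snoc x b : Fin (n + 1) → ℂ) i.castSucc).map (shift c b) =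
      word x (betheL c x) := by
  rw [word, word, List.map_ofFn]
  congr 1
  funext i
  exact shift_betheL c (h i) (h₁ i) (h₂ i)

theorem prod_map_word {n : ℕ} (c : ℝ) (x l : Fin n → ℂ) (b : ℂ) :
    ((word x l).map fun s => f c b s.lam).prod = ∏ i, f c b (x i) := by
  rw [word, List.map_ofFn, List.prod_ofFn]
  rfl

theorem iterate_map_smul (φ : Words →ₗ[ℂ] Words) (k : ℕ) (a : ℂ) (u : Words) :
    φ^[k] (a • u) = a • φ^[k] u := by
  induction k with
  | zero => rfl
  | succ k ih => rw [Function.iterate_succ_apply', Function.iterate_succ_apply', ih, map_smul]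

/-- Removing the last letter from an on-shell ket. -/
theorem opStrip_opPsi_iterate_word (c : ℝ) (k : ℕ) {n : ℕ} {y : Fin n → ℂ} {b : ℂ}
    (h : ∀ i, y i ≠ b) (h₁ : ∀ i, y i - b ≠ Complex.I * c) (h₂ : ∀ i, b - y i ≠ Complex.I * c)
    (l : ℂ) :
    opStrip c b ⟨b, l⟩ ((opPsi c)^[k] (Finsupp.single ((word y fun i =>
      betheL c (Fin.snoc y b : Fin (n + 1) → ℂ) i.castSucc) ++ [⟨b, l⟩]) 1)) =
      (∏ i, f c b (y i)) • (opPsi c)^[k] (Finsupp.single (word y (betheL c y)) 1) := by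
  set ly := fun i : Fin n => betheL c (Fin.snoc y b : Fin (n + 1) → ℂ) i.castSucc
  -- The statement is purely algebraic, so a one-point parameter space with the full algebra
  -- suffices.
  have hC : Coeffs (T := Unit) c ⊤ (Set.range (letters y fun i _ => ly i)) fun _ => ⟨b, l⟩ :=
    ⟨fun _ _ _ _ => trivial, fun _ _ _ _ => trivial, fun _ _ => trivial⟩
  have hW : Tail (Set.range (letters y fun i (_ : Unit) => ly i)) (fun _ => ⟨b, l⟩)
      (List.ofFn (letters y fun i _ => ly i) ++ [fun _ => ⟨b, l⟩]) :=
    tail_append fun s hs => by simpa using hs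
  have := opStrip_opPsi_iterate (b := b) (t := ()) hC rfl ?_ k (Reg.word hW)
  · rw [evalWord_append, evalWord_letters, evalWord_cons, evalWord_nil] at this
    rw [this, opStrip_single, one_smul, strip_append, prod_map_word, map_shift_word c h h₁ h₂]
    · exact iterate_map_smul _ _ _ _
    · intro s hs
      obtain ⟨i, rfl⟩ := mem_word hs
      exact fun hs => h i (congrArg Spec.lam hs)
  · rintro _ ⟨i, rfl⟩
    exact ⟨fun hs => h i (congrArg Spec.lam hs), f_ne_zero c (h i).symm (h₁ i)⟩

/-- Removing the letter closest to the vacuum from an on-shell bra. -/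
theorem opStrip_opPsiDag_iterate_word (c : ℝ) (k : ℕ) {n : ℕ} {y : Fin n → ℂ} {b : ℂ}
    (h : ∀ i, y i ≠ b) (h₁ : ∀ i, y i - b ≠ Complex.I * c) (h₂ : ∀ i, b - y i ≠ Complex.I * c)
    (l : ℂ) :
    opStrip c b ⟨b, l⟩ ((opPsiDag c)^[k] (Finsupp.single ((word y fun i =>
      betheL c (Fin.snoc y b : Fin (n + 1) → ℂ) i.castSucc).reverse ++ [⟨b, l⟩]) 1)) =
      (∏ i, f c b (y i)) •
        (opPsiDag c)^[k] (Finsupp.single (word y (betheL c y)).reverse 1) := by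
  set ly := fun i : Fin n => betheL c (Fin.snoc y b : Fin (n + 1) → ℂ) i.castSucc
  have hC : Coeffs (T := Unit) c ⊤ (Set.range (letters y fun i _ => ly i)) fun _ => ⟨b, l⟩ :=
    ⟨fun _ _ _ _ => trivial, fun _ _ _ _ => trivial, fun _ _ => trivial⟩
  have hW : Tail (Set.range (letters y fun i (_ : Unit) => ly i)) (fun _ => ⟨b, l⟩)
      ((List.ofFn (letters y fun i _ => ly i)).reverse ++ [fun _ => ⟨b, l⟩]) :=
    tail_append fun s hs => by simpa using hs
  have := opStrip_opPsiDag_iterate (b := b) (t := ()) hC rfl ?_ k (Reg.word hW)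
  · rw [evalWord_append, evalWord_reverse, evalWord_letters, evalWord_cons, evalWord_nil] at this
    rw [this, opStrip_single, one_smul, strip_append, List.map_reverse, List.prod_reverse,
      prod_map_word, List.map_reverse, map_shift_word c h h₁ h₂]
    · exact iterate_map_smul _ _ _ _
    · intro s hs
      obtain ⟨i, rfl⟩ := mem_word (List.mem_reverse.1 hs)
      exact fun hs => h i (congrArg Spec.lam hs)
  · rintro _ ⟨i, rfl⟩
    exact ⟨fun hs => h i (congrArg Spec.lam hs), f_ne_zero c (h i).symm (h₁ i)⟩

/-! ### The residue of the form factor -/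

/-- Moving the operator `ℂ(z)` to the vacuum in the definition of the form factor. -/
theorem formFactor_eq_pairing (c : ℝ) (k : ℕ) {n : ℕ} {x y : Fin n → ℂ} {b z : ℂ}
    (hx : Function.Injective x) (hy : Function.Injective y) (hxy : ∀ i j, x i ≠ y j)
    (hxb : ∀ i, x i ≠ b) (hyb : ∀ i, y i ≠ b) (hzb : z ≠ b) (hxz : ∀ i, x i ≠ z)
    (hyz : ∀ i, y i ≠ z) :
    formFactor c k (Fin.snoc x z : Fin (n + 1) → ℂ) (Fin.snoc y b : Fin (n + 1) → ℂ) =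
      pairing c
        ((opPsiDag c)^[k] (Finsupp.single ((word x fun i =>
          betheL c (Fin.snoc x z : Fin (n + 1) → ℂ) i.castSucc).reverse ++
            [⟨z, betheL c (Fin.snoc x z : Fin (n + 1) → ℂ) (Fin.last n)⟩]) 1))
        ((opPsi c)^[k] (Finsupp.single ((word y fun i =>
          betheL c (Fin.snoc y b : Fin (n + 1) → ℂ) i.castSucc) ++
            [⟨b, betheL c (Fin.snoc y b : Fin (n + 1) → ℂ) (Fin.last n)⟩]) 1)) := by
  rw [formFactor, offShell, word_snoc, word_snoc, List.reverse_append]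
  -- Reversal makes `ℂ(z)` the head of the bra word, so that it would act first; the permutation
  -- moves it to the vacuum end.
  refine pairing_perm c k List.perm_append_comm ?_ ?_ ?_
  · rw [← List.reverse_append, ← word_snoc, List.map_reverse, List.nodup_reverse, map_lam_word,
      List.nodup_ofFn]
    exact Fin.snoc_injective_of_injective hx fun ⟨i, hi⟩ => hxz i hi
  · rw [← word_snoc, map_lam_word, List.nodup_ofFn]
    exact Fin.snoc_injective_of_injective hy fun ⟨i, hi⟩ => hyb i hi
  · rw [← List.reverse_append, ← word_snoc, ← word_snoc]
    intro s hs t ht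
    obtain ⟨i, rfl⟩ := mem_word (List.mem_reverse.1 hs)
    obtain ⟨j, rfl⟩ := mem_word ht
    induction i using Fin.lastCases with
    | last =>
      induction j using Fin.lastCases with
      | last => simpa using hzb
      | cast j => simpa using (hyz j).symm
    | cast i =>
      induction j using Fin.lastCases with
      | last => simpa using hxb i
      | cast j => simpa using hxy i j

theorem eventually_forall_ne {n : ℕ} {x : Fin n → ℂ} {b : ℂ} (h : ∀ i, x i ≠ b) :
    ∀ᶠ z in 𝓝[≠] b, ∀ i, x i ≠ z :=
  eventually_all.2 fun i =>
    ((continuousAt_id.eventually_ne (h i).symm).filter_mono nhdsWithin_le_nhds).mono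
      fun _ hz => hz.symm

theorem formFactor_residue (c : ℝ) (k : ℕ) {n : ℕ} {x y : Fin n → ℂ} {b : ℂ}
    (hx : Function.Injective x) (hy : Function.Injective y)
    (hxy : ∀ i j, x i ≠ y j) (hxb : ∀ i, x i ≠ b) (hyb : ∀ i, y i ≠ b)
    (hxbc : ∀ i, x i - b ≠ Complex.I * c ∧ b - x i ≠ Complex.I * c)
    (hybc : ∀ i, y i - b ≠ Complex.I * c ∧ b - y i ≠ Complex.I * c) :
    ∃ G H : ℂ → ℂ, AnalyticAt ℂ G b ∧ AnalyticAt ℂ H b ∧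
      G b = kinFactor c x y b b * formFactor c k x y ∧ ∀ᶠ z in 𝓝[≠] b,
        formFactor c k (Fin.snoc x z : Fin (n + 1) → ℂ) (Fin.snoc y b : Fin (n + 1) → ℂ) =
          Complex.I * c / (z - b) * G z + H z := by
  set lx : Fin n → ℂ → ℂ := fun i z => betheL c (Fin.snoc x z : Fin (n + 1) → ℂ) i.castSucc
    with hlx
  set lz : ℂ → ℂ := fun z => betheL c (Fin.snoc x z : Fin (n + 1) → ℂ) (Fin.last n) with hlz
  set ly : Fin n → ℂ := fun i => betheL c (Fin.snoc y b : Fin (n + 1) → ℂ) i.castSucc with hly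
  set lb : ℂ := betheL c (Fin.snoc y b : Fin (n + 1) → ℂ) (Fin.last n) with hlb
  set Z : ℂ → Spec := fun z => ⟨z, lz z⟩
  set β : ℂ → Spec := fun _ => ⟨b, lb⟩
  have alx : ∀ i, AnalyticAt ℂ (lx i) b := fun i => by
    simp only [hlx, betheL_snoc_castSucc]
    refine analyticAt_const.mul (analyticAt_inv_S c (analyticAt_id.sub analyticAt_const)
      (hxbc i).2 ?_)
    simpa using (hxbc i).1
  have alz : AnalyticAt ℂ lz b := by
    simp only [hlz, betheL_snoc_last]
    refine Finset.analyticAt_fun_prod _ fun i _ => analyticAt_inv_S c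
      (analyticAt_const.sub analyticAt_id) (hxbc i).1 ?_
    simpa using (hxbc i).2
  -- Both sets of rapidities are pooled, since the action of the `ℂ(x i)` leaves letters `x i` in
  -- the ket.
  set p : Fin n ⊕ Fin n → ℂ := Sum.elim x y
  set l : Fin n ⊕ Fin n → ℂ → ℂ := Sum.elim lx fun i _ => ly i
  have al : ∀ i, AnalyticAt ℂ (l i) b := by
    rintro (i | i)
    · exact alx i
    · exact analyticAt_const
  have hpb : ∀ i, p i ≠ b := by
    rintro (i | i)
    · exact hxb i
    · exact hyb i
  have hpbc : ∀ i, p i - b ≠ Complex.I * c := by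
    rintro (i | i)
    · exact (hxbc i).1
    · exact (hybc i).1
  have hU : Coeffs c (analyticFunctions b) (Set.range (letters p l)) β :=
    coeffs_letters c al analyticAt_const analyticAt_const hpb
  have hX : Coeffs c (analyticFunctions b) (Set.range (letters x lx)) Z :=
    coeffs_letters c alx analyticAt_id alz hxb
  have hφ := hX.opPsiDag_iterate k (Reg.word (tail_append (e := Z)
    (w := (List.ofFn (letters x lx)).reverse) fun s hs => by simpa using hs))
  have hv := hU.opPsi_iterate k (Reg.word (tail_append (e := β)
    (w := List.ofFn (letters y fun i _ => ly i)) fun s hs => by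
      obtain ⟨i, rfl⟩ := List.mem_ofFn.1 hs
      exact ⟨.inr i, rfl⟩))
  have hXU : Set.range (letters x lx) ⊆ Set.range (letters p l) := by
    rintro _ ⟨i, rfl⟩
    exact ⟨.inl i, rfl⟩
  have hβU : ∀ s ∈ Set.range (letters p l), ∀ z, s z ≠ β z ∧ f c b (s z).lam ≠ 0 := by
    rintro _ ⟨i, rfl⟩ z
    exact ⟨fun h => hpb i (congrArg Spec.lam h), f_ne_zero c (hpb i).symm (hpbc i)⟩
  have hg : ∀ s ∈ Set.range (letters p l),
      (fun z => g c (Z z).lam (s z).lam) ∈ analyticFunctions b := by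
    rintro _ ⟨i, rfl⟩
    exact analyticAt_g c analyticAt_id analyticAt_const (hpb i).symm
  have hXZ : ∀ s ∈ Set.range (letters x lx), s b ≠ Z b := by
    rintro _ ⟨i, rfl⟩ h
    exact hxb i (congrArg Spec.lam h)
  obtain ⟨E, hE, H, hH, e, e₀⟩ :=
    pairing_residue (b := b) hU hXU (fun _ => rfl) hβU hg alz b hXZ hφ hv
  simp only [evalWord_append, evalWord_reverse, evalWord_letters, evalWord_cons,
    evalWord_nil] at e e₀
  -- As `g(z,b) = ic/(z - b)`, the remaining factor `(l(z) - l(b)) E(z)` is `G`. It is compared with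
  -- `K 𝔽_{2N-2}` only at `z = b`.
  refine ⟨fun z => (lz z - lb) * E z, H, (alz.sub analyticAt_const).mul hE, hH, ?_, ?_⟩
  · have h₁ := betheL_snoc_last_mul c hxb (fun i => (hxbc i).1) fun i => (hxbc i).2
    have h₂ := betheL_snoc_last_mul c hyb (fun i => (hybc i).1) fun i => (hybc i).2
    have h₃ : E b = (∏ i, f c b (x i)) * (∏ i, f c b (y i)) * formFactor c k x y := by
      rw [e₀, opStrip_opPsiDag_iterate_word c k hxb (fun i => (hxbc i).1) (fun i => (hxbc i).2),
        opStrip_opPsi_iterate_word c k hyb (fun i => (hybc i).1) (fun i => (hybc i).2),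
        pairing_eq, map_smul, pairingWith_smul, ← pairing_eq, smul_eq_mul, ← mul_assoc]
      rfl
    simp only [h₃, kinFactor, Finset.prod_mul_distrib, ← h₁, ← h₂, hlz, hlb]
    ring
  · filter_upwards [self_mem_nhdsWithin, eventually_forall_ne hxb, eventually_forall_ne hyb]
      with z hzb hxz hyz
    rw [formFactor_eq_pairing c k hx hy hxy hxb hyb hzb hxz hyz, e z, g]
    ring

theorem analyticAt_dslope {G : ℂ → ℂ} {b : ℂ} (h : AnalyticAt ℂ G b) :
    AnalyticAt ℂ (dslope G b) b :=
  let ⟨_, hp⟩ := h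
  ⟨_, hp.has_fpower_series_dslope_fslope⟩

theorem analyticAt_kinFactor (c : ℝ) {n : ℕ} {x : Fin n → ℂ} (y : Fin n → ℂ) {b : ℂ}
    (hxb : ∀ i, x i ≠ b) : AnalyticAt ℂ (fun z => kinFactor c x y z b) b :=
  (Finset.analyticAt_fun_prod _ fun i _ =>
    (analyticAt_f c analyticAt_const analyticAt_id (hxb i)).mul analyticAt_const).sub
  (Finset.analyticAt_fun_prod _ fun i _ =>
    analyticAt_const.mul (analyticAt_f c analyticAt_id analyticAt_const (hxb i).symm))

end BoseGas

end

/-! ### The simple pole and its residue -/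

theorem mainTheorem6 (c : ℝ) (hc : c ≠ 0) (n : ℕ) (x y : Fin n → ℂ) (b : ℂ)
    (hx : Function.Injective x) (hy : Function.Injective y)
    (hxy : ∀ i j, x i ≠ y j) (hxb : ∀ i, x i ≠ b) (hyb : ∀ i, y i ≠ b)
    (hxx : ∀ i j, x i - x j ≠ Complex.I * c) (hyy : ∀ i j, y i - y j ≠ Complex.I * c)
    (hxbc : ∀ i, x i - b ≠ Complex.I * c ∧ b - x i ≠ Complex.I * c)
    (hybc : ∀ i, y i - b ≠ Complex.I * c ∧ b - y i ≠ Complex.I * c)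
    (k : ℕ) :
    (∃ h : ℂ → ℂ, AnalyticAt ℂ h b ∧ ∀ᶠ z in 𝓝[≠] b,
      BoseGas.formFactor c k (Fin.snoc x z : Fin (n + 1) → ℂ) (Fin.snoc y b : Fin (n + 1) → ℂ) =
        Complex.I * c / (z - b) * BoseGas.kinFactor c x y z b * BoseGas.formFactor c k x y
          + h z) ∧
    Tendsto (fun z => (z - b) *
        BoseGas.formFactor c k (Fin.snoc x z : Fin (n + 1) → ℂ) (Fin.snoc y b : Fin (n + 1) → ℂ))
      (𝓝[≠] b)
      (𝓝 (Complex.I * c * BoseGas.kinFactor c x y b b * BoseGas.formFactor c k x y)) ∧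
    (BoseGas.kinFactor c x y b b * BoseGas.formFactor c k x y ≠ 0 →
      meromorphicOrderAt (fun z => BoseGas.formFactor c k (Fin.snoc x z : Fin (n + 1) → ℂ)
        (Fin.snoc y b : Fin (n + 1) → ℂ)) b = -1) := by
  set F := fun z => BoseGas.formFactor c k (Fin.snoc x z : Fin (n + 1) → ℂ)
    (Fin.snoc y b : Fin (n + 1) → ℂ)
  set K := fun z => BoseGas.kinFactor c x y z b
  set F₀ := BoseGas.formFactor c k x y
  have hK : AnalyticAt ℂ K b := BoseGas.analyticAt_kinFactor c y hxb
  obtain ⟨G, H, hG, hH, hGb, hF⟩ := BoseGas.formFactor_residue c k hx hy hxy hxb hyb hxbc hybc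
  -- Numerator of `F` over `z - b`. Its value `ic · G b` at `b` gives the limit, and its
  -- nonvanishing gives order exactly `-1`.
  have hP : AnalyticAt ℂ (fun z => Complex.I * c * G z + (z - b) * H z) b :=
    (analyticAt_const.mul hG).add ((analyticAt_id.sub analyticAt_const).mul hH)
  have hF' : ∀ᶠ z in 𝓝[≠] b, F z = (z - b) ^ (-1 : ℤ) • (Complex.I * c * G z + (z - b) * H z) := by
    filter_upwards [hF, self_mem_nhdsWithin] with z hz hzb
    have : z - b ≠ 0 := sub_ne_zero.2 hzb
    rw [zpow_neg_one, smul_eq_mul, show F z = _ from hz]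
    field_simp
  -- `G - K F₀` vanishes at `b`, so its quotient by `z - b` extends analytically as a `dslope`,
  -- which is absorbed into `h`.
  refine ⟨⟨fun z => H z + Complex.I * c * dslope (fun z => G z - K z * F₀) b z, ?_, ?_⟩, ?_, ?_⟩
  · exact hH.add (analyticAt_const.mul
      (BoseGas.analyticAt_dslope (hG.sub (hK.mul analyticAt_const))))
  · filter_upwards [hF, self_mem_nhdsWithin] with z hz hzb
    have : z - b ≠ 0 := sub_ne_zero.2 hzb
    rw [hz, dslope_of_ne _ hzb, slope_def_field, hGb, sub_self, sub_zero]
    field_simp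
    ring
  · have h := hP.continuousAt.tendsto.mono_left (nhdsWithin_le_nhds (s := {b}ᶜ))
    rw [sub_self, zero_mul, add_zero, hGb, ← mul_assoc] at h
    refine h.congr' ?_
    filter_upwards [hF', self_mem_nhdsWithin] with z hz hzb
    have : z - b ≠ 0 := sub_ne_zero.2 hzb
    rw [show BoseGas.formFactor c k _ _ = F z from rfl, hz, zpow_neg_one, smul_eq_mul,
      mul_inv_cancel_left₀ this]
  · intro hne
    have hm : MeromorphicAt F b := by
      refine MeromorphicAt.congr (f := fun z =>
        (z - b) ^ (-1 : ℤ) • (Complex.I * c * G z + (z - b) * H z)) ?_ (hF'.mono fun _ => Eq.symm)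
      exact (((MeromorphicAt.id b).sub (MeromorphicAt.const b b)).zpow (-1)).smul hP.meromorphicAt
    refine (meromorphicOrderAt_eq_int_iff (n := -1) hm).2 ⟨_, hP, ?_, hF'⟩
    simpa [hGb, hc] using hne
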